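/- Let $\hbar, M, L>0$ and $\nu,\beta\ge 0$ be real, and put $\varepsilon_0=\hbar^2\pi^2/(2ML^2)$ and, for $n\in\mathbb N=\{0,1,2,\dots\}$, $$E_n=\varepsilon_0\Big((n+\nu+1)^2-\frac{\beta^2}{(n+\nu+1)^2}\Big),\qquad a_n=-(n+\nu+1)+\frac{i\beta}{n+\nu+1},$$ $$\phi_n(x)=K_n\,\sin^{\nu+n+1}\!\Big(\frac{\pi x}{L}\Big)\exp\!\Big(-\frac{\beta\pi x}{L(\nu+n+1)}\Big)P_n^{(a_n,\bar a_n)}\!\Big(i\cot\frac{\pi x}{L}\Big),\qquad 0<x<L,$$ where $P_n^{(a,b)}$ are the Jacobi polynomials and $K_n>0$ is the normalization constant for which $\int_0^L|\phi_n|^2\,dx=1$. (These are the eigenvalues and normalized eigenfunctions of the Pöschl–Teller Hamiltonian $-\frac{\hbar^2}{2M}\frac{d^2}{dx^2}+\varepsilon_0\big(\frac{\nu(\nu+1)}{\sin^2(\pi x/L)}-2\beta\cot\frac{\pi x}{L}\big)$ on $L^2([0,L])$.) Define recursively, for $m=0,1,2,\dots$, the hierarchic eigenfunctions $\phi^{(m)}_n$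 (with $\phi_n^{(0)}=\phi_n$), the superpotentials $W_m$ and the operators $A_m$ by $$\phi^{(m)}_n=\frac{A_{m-1}\cdots A_1A_0\,\phi_{n+m}}{\sqrt{(2M)^m\prod_{k=0}^{m-1}(E_{n+m}-E_k)}},\qquad W_m=-\hbar\,\frac{(\phi^{(m)}_0)'}{\phi^{(m)}_0},\qquad A_m=\hbar\frac{d}{dx}+W_m .$$ As an operator in $L^2([0,L])$, $A_m$ acts on the functions $u\in L^2([0,L])$ that are absolutely continuous on every compact subinterval of $(0,L)$ and satisfy $\hbar u'+W_mu\in L^2([0,L])$. Let $\dagger$ denote the Hilbert space adjoint, let products of operators have their natural domains, and put $${}_{m+1}\Lambda_n=A_nA_{n-1}\cdots A_{m+1}\quad(m<n),\qquad {}^{n+1}\Theta_m=A_{n+1}^\dagger A_{n+2}^\dagger\cdots A_m^\dagger\quad(n<m).$$ For $n,m\in\mathbb N$ let $\mathcal M(n,m)\ge 0$ and $\mathcal N(n,m)$ be given by $$\mathcal M^2(n,m)=\prod_{k=0}^{m}(n+m-k+1)(n+m+2\nu+k+3)\Big(1+\frac{\beta^2}{[(k+\nu+1)(n+m+\nu+2)]^2}\Big),$$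 $$\mathcal N(n,m)=\prod_{k=0}^{m}(2n-k+1)(2n+2\nu+k+3)\Big(1+\frac{\beta^2}{[(k+\nu+1)(2n+\nu+2)]^2}\Big).$$ For an operator $X$ and a function $\phi$ in its domain write $\langle X\rangle_\phi=\int_0^L\overline{\phi}\,X\phi\,dx$. Then the following mean values exist (each state lies in the domain of the operator in question) and are given as follows. If $m<n$, $$\big\langle {}_{m+1}\Lambda_n\,{}_{m+1}\Lambda_n^\dagger\big\rangle_{\phi^{(n+1)}_n}=\Big[\Big(\frac{\pi\hbar}{L}\Big)^{n-m}\Big]^2\,\mathcal N(n,n)\,\mathcal N^{-1}(n,m),$$ $$\big\langle {}_{m+1}\Lambda_n^\dagger\,{}_{m+1}\Lambda_n\big\rangle_{\phi^{(m+1)}_n}=\Big[\Big(\frac{\pi\hbar}{L}\Big)^{n-m}\mathcal M(m,n)\,\mathcal M^{-1}(n,m)\Big]^2;$$ if $n<m$, $$\big\langle {}^{n+1}\Theta_m\,{}^{n+1}\Theta_m^\dagger\big\rangle_{\phi^{(n+1)}_n}=\Big[\Big(\frac{\pi\hbar}{L}\Big)^{m-n}\Big]^2\,\mathcal N^{-1}(n,n)\,\mathcal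 N(n,m),$$ $$\big\langle {}^{n+1}\Theta_m^\dagger\,{}^{n+1}\Theta_m\big\rangle_{\phi^{(m+1)}_n}=\Big[\Big(\frac{\pi\hbar}{L}\Big)^{m-n}\mathcal M(n,m)\,\mathcal M^{-1}(m,n)\Big]^2.$$ Moreover $\mathcal N(n,n)=\mathcal M^2(n,n)$ for every $n\in\mathbb N$. -/

import Mathlib

open MeasureTheory
open scoped InnerProductSpace

namespace PoschlTeller

/-! ### The model -/

/-- The real parameters of the model: `ħ`, the particle mass, the length `L` of the interval,
and the dimensionless parameters `ν` and `β` of the potential. -/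
structure Params where
  hbar : ℝ
  mass : ℝ
  L : ℝ
  nu : ℝ
  beta : ℝ

/-- Lebesgue measure on the open interval `(0, L)`. -/
noncomputable def mu (L : ℝ) : Measure ℝ := volume.restrict (Set.Ioo 0 L)

/-- The Hilbert space `L²([0, L], dx)` of complex-valued functions. -/
abbrev Hilb (L : ℝ) : Type := Lp ℂ 2 (mu L)

/-- The energy scale `ε₀ = ħ² π² / (2 M L²)`. -/
noncomputable def Params.eps (p : Params) : ℝ :=
  p.hbar ^ 2 * Real.pi ^ 2 / (2 * p.mass * p.L ^ 2)

/-- The eigenvalues `E_n = ε₀ ((n + ν + 1)² - β² / (n + ν + 1)²)`. -/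
noncomputable def Params.energy (p : Params) (n : ℕ) : ℝ :=
  p.eps * ((n + p.nu + 1) ^ 2 - p.beta ^ 2 / (n + p.nu + 1) ^ 2)

/-! ### The eigenfunctions of the Pöschl-Teller Hamiltonian -/

/-- The Jacobi polynomial `P_n^{(a, b)}(z)`, for arbitrary complex parameters:
`∑_{k ≤ n} (n + a + b + 1)_k (a + k + 1)_{n - k} / (k! (n - k)!) ((z - 1) / 2)^k`. -/
noncomputable def jacobi (n : ℕ) (a b z : ℂ) : ℂ :=
  ∑ k ∈ Finset.range (n + 1),
    (ascPochhammer ℂ k).eval (n + a + b + 1) * (ascPochhammer ℂ (n - k)).eval (a + k + 1) /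
      ((k.factorial : ℂ) * ((n - k).factorial : ℂ)) * ((z - 1) / 2) ^ k

/-- The parameter `a_n = -(n + ν + 1) + i β / (n + ν + 1)`. -/
noncomputable def Params.a (p : Params) (n : ℕ) : ℂ :=
  -((n + p.nu + 1 : ℝ) : ℂ) + Complex.I * ((p.beta / (n + p.nu + 1) : ℝ) : ℂ)

/-- The eigenfunction before normalization,
`sin^{ν+n+1}(π x / L) exp(-β π x / (L (ν+n+1))) P_n^{(a_n, conj a_n)}(i cot(π x / L))`. -/
noncomputable def Params.rawEigenfun (p : Params) (n : ℕ) (x : ℝ) : ℂ :=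
  ((Real.sin (Real.pi * x / p.L) ^ (p.nu + n + 1) *
      Real.exp (-(p.beta * Real.pi * x / (p.L * (p.nu + n + 1)))) : ℝ) : ℂ) *
    jacobi n (p.a n) (starRingEnd ℂ (p.a n)) (Complex.I * (Real.cot (Real.pi * x / p.L) : ℂ))

/-- The normalization constant `K_n > 0`, which makes the eigenfunction a unit vector of
`L²([0, L])`. -/
noncomputable def Params.normConst (p : Params) (n : ℕ) : ℝ :=
  (Real.sqrt (∫ x in (0 : ℝ)..p.L, ‖p.rawEigenfun n x‖ ^ 2))⁻¹

/-- The normalized eigenfunction `φ_n`. -/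
noncomputable def Params.eigenfun (p : Params) (n : ℕ) (x : ℝ) : ℂ :=
  (p.normConst n : ℂ) * p.rawEigenfun n x

/-! ### The hierarchy -/

/-- The first order differential expression `ħ f' + W f`. -/
noncomputable def applyA (hbar : ℝ) (W f : ℝ → ℂ) (x : ℝ) : ℂ :=
  (hbar : ℂ) * deriv f x + W x * f x

/-- The superpotential `-ħ f' / f` that belongs to the ground state `f`. -/
noncomputable def superpotOf (hbar : ℝ) (f : ℝ → ℂ) (x : ℝ) : ℂ :=
  -(hbar : ℂ) * deriv f x / f x

/-- The constant `√((2M)^m ∏_{k < m} (E_j - E_k))`. -/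
noncomputable def Params.hierNorm (p : Params) (m j : ℕ) : ℝ :=
  Real.sqrt ((2 * p.mass) ^ m * ∏ k ∈ Finset.range m, (p.energy j - p.energy k))

/-- `ladder m j` is the function `A_{m-1} ⋯ A_1 A_0 φ_j`, where `A_k = ħ d/dx + W_k` and
`W_k = -ħ (φ_0^{(k)})' / φ_0^{(k)}` is built from the ground state
`φ_0^{(k)} = A_{k-1} ⋯ A_0 φ_k / √((2M)^k ∏_{i < k} (E_k - E_i))` of the previous stage. -/
noncomputable def Params.ladder (p : Params) : ℕ → ℕ → ℝ → ℂ
  | 0, j => p.eigenfun j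
  | m + 1, j =>
      applyA p.hbar
        (superpotOf p.hbar (fun x => p.ladder m m x / (p.hierNorm m m : ℂ)))
        (p.ladder m j)

/-- The hierarchic eigenfunction
`φ_n^{(m)} = A_{m-1} ⋯ A_1 A_0 φ_{n+m} / √((2M)^m ∏_{k < m} (E_{n+m} - E_k))`. -/
noncomputable def Params.hierEigenfun (p : Params) (m n : ℕ) (x : ℝ) : ℂ :=
  p.ladder m (n + m) x / (p.hierNorm m (n + m) : ℂ)

/-- The superpotential `W_m = -ħ (φ_0^{(m)})' / φ_0^{(m)}`. -/
noncomputable def Params.superpot (p : Params) (m : ℕ) : ℝ → ℂ :=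
  superpotOf p.hbar (p.hierEigenfun m 0)

theorem Params.ladder_succ (p : Params) (m j : ℕ) :
    p.ladder (m + 1) j = applyA p.hbar (p.superpot m) (p.ladder m j) := by
  have h : p.hierEigenfun m 0 = fun x => p.ladder m m x / (p.hierNorm m m : ℂ) := by
    funext x
    simp only [Params.hierEigenfun, zero_add]
  rw [Params.superpot, h, Params.ladder]

/-! ### The operators `A_m` and their products in `L²([0, L])` -/

/-- `f` is absolutely continuous on every compact subinterval of `(0, L)`, with (almost
everywhere) derivative `g`. -/
def HasACDeriv (L : ℝ) (f g : ℝ → ℂ) : Prop :=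
  ∀ a ∈ Set.Ioo 0 L, ∀ b ∈ Set.Ioo 0 L,
    IntervalIntegrable g volume a b ∧ f b - f a = ∫ t in a..b, g t

theorem HasACDeriv.add {L : ℝ} {f₁ g₁ f₂ g₂ : ℝ → ℂ} (h₁ : HasACDeriv L f₁ g₁)
    (h₂ : HasACDeriv L f₂ g₂) : HasACDeriv L (f₁ + f₂) (g₁ + g₂) := by
  intro a ha b hb
  obtain ⟨i₁, e₁⟩ := h₁ a ha b hb
  obtain ⟨i₂, e₂⟩ := h₂ a ha b hb
  refine ⟨i₁.add i₂, ?_⟩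
  have := intervalIntegral.integral_add i₁ i₂
  simp only [Pi.add_apply]
  rw [this, ← e₁, ← e₂]
  ring

theorem HasACDeriv.smul {L : ℝ} {f g : ℝ → ℂ} (c : ℂ) (h : HasACDeriv L f g) :
    HasACDeriv L (c • f) (c • g) := by
  intro a ha b hb
  obtain ⟨i, e⟩ := h a ha b hb
  refine ⟨i.smul c, ?_⟩
  have := intervalIntegral.integral_smul (μ := volume) (a := a) (b := b) c g
  simp only [Pi.smul_apply]
  rw [this, ← e, smul_sub]

/-- The graph of the operator `ħ d/dx + W` in `L²([0, L])` on its maximal domain: the pairs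
`(u, ħ u' + W u)` with `u` in `L²` absolutely continuous in `(0, L)` and `ħ u' + W u` in `L²`. -/
def graphA (L hbar : ℝ) (W : ℝ → ℂ) : Submodule ℂ (Hilb L × Hilb L) where
  carrier := {q | ∃ f g : ℝ → ℂ, HasACDeriv L f g ∧ q.1 =ᵐ[mu L] f ∧
    q.2 =ᵐ[mu L] fun x => (hbar : ℂ) * g x + W x * f x}
  zero_mem' := by
    refine ⟨0, 0, fun a _ b _ => ⟨?_, by simp⟩, Lp.coeFn_zero _ _ _, ?_⟩
    · exact intervalIntegrable_const
    · filter_upwards [Lp.coeFn_zero ℂ 2 (mu L)] with x hx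
      simpa using hx
  add_mem' := by
    rintro q r ⟨f₁, g₁, h₁, hu₁, hv₁⟩ ⟨f₂, g₂, h₂, hu₂, hv₂⟩
    refine ⟨f₁ + f₂, g₁ + g₂, h₁.add h₂, ?_, ?_⟩
    · filter_upwards [hu₁, hu₂, Lp.coeFn_add q.1 r.1] with x h1 h2 h3
      simp only [Prod.fst_add, h3, Pi.add_apply, h1, h2]
    · filter_upwards [hv₁, hv₂, Lp.coeFn_add q.2 r.2] with x h1 h2 h3
      simp only [Prod.snd_add, h3, Pi.add_apply, h1, h2]
      ring
  smul_mem' := by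
    rintro c q ⟨f, g, h, hu, hv⟩
    refine ⟨c • f, c • g, h.smul c, ?_, ?_⟩
    · filter_upwards [hu, Lp.coeFn_smul c q.1] with x h1 h3
      simp only [Prod.smul_fst, h3, Pi.smul_apply, h1]
    · filter_upwards [hv, Lp.coeFn_smul c q.2] with x h1 h3
      simp only [Prod.smul_snd, h3, Pi.smul_apply, h1, smul_eq_mul]
      ring

/-- The relation `graphA` is single-valued, hence really the graph of an operator. -/
theorem graphA_snd_eq_zero (L hbar : ℝ) (W : ℝ → ℂ) (q : Hilb L × Hilb L)
    (hq : q ∈ graphA L hbar W) (h0 : q.1 = 0) : q.2 = 0 := by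
  obtain ⟨f, g, h, hu, hv⟩ := hq
  have hf0 : ∀ᵐ x ∂(volume : Measure ℝ), x ∈ Set.Ioo 0 L → f x = 0 := by
    have h1 : ∀ᵐ x ∂(mu L), f x = 0 := by
      filter_upwards [hu, (h0 ▸ Lp.coeFn_zero ℂ 2 (mu L) : (q.1 : ℝ → ℂ) =ᵐ[mu L] 0)]
        with x hx hx'
      rw [← hx, hx']
      rfl
    exact (ae_restrict_iff' measurableSet_Ioo).1 h1
  have hg0 : ∀ᵐ x ∂(volume : Measure ℝ), x ∈ Set.Ioo 0 L → g x = 0 := by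
    have key : ∀ k : ℕ, ∀ᵐ x ∂(volume : Measure ℝ),
        x ∈ Set.Ioo (L / (k + 3)) (L - L / (k + 3)) → 0 < L → g x = 0 := by
      intro k
      by_cases hL : 0 < L
      swap
      · exact Filter.Eventually.of_forall fun x _ h => absurd h hL
      have hk : (0 : ℝ) < k + 3 := by positivity
      have hlt : L / (k + 3) ≤ L / 3 := by
        apply div_le_div_of_nonneg_left hL.le (by norm_num)
        linarith [(Nat.cast_nonneg k : (0 : ℝ) ≤ k)]
      have hpos : 0 < L / (k + 3) := by positivity
      have ha : L / (k + 3) ∈ Set.Ioo 0 L := ⟨hpos, by linarith⟩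
      have hb : L - L / (k + 3) ∈ Set.Ioo 0 L := ⟨by linarith, by linarith⟩
      filter_upwards [(h _ ha _ hb).1.ae_hasDerivAt_integral] with x hx hxI _
      have hxI' : x ∈ Set.uIcc (L / (k + 3)) (L - L / (k + 3)) := by
        rw [Set.uIcc_of_le (by linarith)]
        exact ⟨hxI.1.le, hxI.2.le⟩
      have hx0 : x ∈ Set.Ioo 0 L := ⟨hpos.trans hxI.1, hxI.2.trans hb.2⟩
      have hd := hx hxI' _ hxI'
      have hd' : HasDerivAt f (g x) x := by
        have : f =ᶠ[nhds x] fun y => f x + ∫ t in x..y, g t := by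
          filter_upwards [isOpen_Ioo.mem_nhds hx0] with y hy
          rw [← (h x hx0 y hy).2]
          ring
        exact (hd.const_add (f x)).congr_of_eventuallyEq this
      have hfreq : ∃ᶠ y in nhdsWithin x {x}ᶜ, f y = 0 := by
        rw [Filter.frequently_iff]
        intro U hU
        have hvol : volume (U ∩ Set.Ioo 0 L) ≠ 0 := by
          obtain ⟨O, hO, hxO, hOU⟩ := mem_nhdsWithin.1 hU
          have hne : (O ∩ Set.Ioo 0 L).Nonempty := ⟨x, hxO, hx0⟩
          have := (hO.inter isOpen_Ioo).measure_pos volume hne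
          intro hz
          have hle : volume (O ∩ Set.Ioo 0 L) ≤ volume (U ∩ Set.Ioo 0 L) + volume {x} := by
            refine (measure_mono ?_).trans (measure_union_le _ _)
            intro y hy
            by_cases hyx : y = x
            · exact Or.inr hyx
            · exact Or.inl ⟨hOU ⟨hy.1, hyx⟩, hy.2⟩
          rw [hz, Real.volume_singleton, add_zero] at hle
          exact absurd this (not_lt.2 hle)
        by_contra hcon
        push Not at hcon
        refine hvol (measure_mono_null ?_ hf0)
        intro y hy hy'
        exact hcon y hy.1 (hy' hy.2)
      have hcont : f x = 0 := by
        have : ContinuousAt f x := hd'.continuousAt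
        by_contra hne
        have hev : ∀ᶠ y in nhdsWithin x {x}ᶜ, f y ≠ 0 :=
          (this.eventually_ne hne).filter_mono nhdsWithin_le_nhds
        obtain ⟨y, hy, hy'⟩ := (hfreq.and_eventually hev).exists
        exact hy' hy
      by_contra hne
      have hev := hd'.eventually_ne (c := 0) hne
      obtain ⟨y, hy, hy'⟩ := (hfreq.and_eventually hev).exists
      exact hy' hy
    filter_upwards [ae_all_iff.2 key] with x hx hxI
    have hL : 0 < L := hxI.1.trans hxI.2
    obtain ⟨k, hk⟩ := exists_nat_gt (max (L / x) (L / (L - x)))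
    have hk3 : (0 : ℝ) < k + 3 := by positivity
    refine hx k ⟨?_, ?_⟩ hL
    · rw [div_lt_iff₀ hk3]
      have := (div_lt_iff₀ hxI.1).1 ((le_max_left _ _).trans_lt hk)
      nlinarith [hxI.1]
    · have hpos : 0 < L - x := sub_pos.2 hxI.2
      have h1 := (div_lt_iff₀ hpos).1 ((le_max_right _ _).trans_lt hk)
      have h2 : L / (k + 3) < L - x := by
        rw [div_lt_iff₀ hk3]
        nlinarith
      linarith
  apply Lp.ext
  have hf0' : ∀ᵐ x ∂(mu L), f x = 0 := (ae_restrict_iff' measurableSet_Ioo).2 hf0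
  have hg0' : ∀ᵐ x ∂(mu L), g x = 0 := (ae_restrict_iff' measurableSet_Ioo).2 hg0
  filter_upwards [hv, hf0', hg0', Lp.coeFn_zero ℂ 2 (mu L)] with x h1 h2 h3 h4
  rw [h1, h2, h3, h4]
  simp

/-- The operator `A_m = ħ d/dx + W_m` in `L²([0, L])`, on the domain of all `u` in `L²` that are
absolutely continuous in `(0, L)` and satisfy `ħ u' + W_m u ∈ L²`. -/
noncomputable def Params.opA (p : Params) (m : ℕ) : Hilb p.L →ₗ.[ℂ] Hilb p.L :=
  (graphA p.L p.hbar (p.superpot m)).toLinearPMap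

/-- The product `S T` of two partially defined operators, on its natural domain
`{u ∈ dom T | T u ∈ dom S}`. -/
noncomputable def opMul {L : ℝ} (S T : Hilb L →ₗ.[ℂ] Hilb L) : Hilb L →ₗ.[ℂ] Hilb L :=
  S.comp (T.domRestrict ((S.domain.comap T.toFun).map T.domain.subtype)) (by
    rintro ⟨x, hx⟩
    obtain ⟨⟨y, hy, hyx⟩, hT⟩ := hx
    have hval : T.domRestrict ((S.domain.comap T.toFun).map T.domain.subtype)
        ⟨x, ⟨⟨y, hy, hyx⟩, hT⟩⟩ = T y :=
      LinearPMap.domRestrict_apply hyx.symm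
    rw [hval]
    exact hy)

/-- The product `T₁ T₂ ⋯ T_r` of a list of partially defined operators, on its natural domain. -/
noncomputable def opProd {L : ℝ} : List (Hilb L →ₗ.[ℂ] Hilb L) → (Hilb L →ₗ.[ℂ] Hilb L)
  | [] => LinearMap.id.toPMap ⊤
  | T :: l => opMul T (opProd l)

/-- `Λ_{m,n} = A_n A_{n-1} ⋯ A_{m+1}`. -/
noncomputable def Params.opLambda (p : Params) (m n : ℕ) : Hilb p.L →ₗ.[ℂ] Hilb p.L :=
  opProd ((List.Ico (m + 1) (n + 1)).reverse.map p.opA)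

/-- `Θ_{n,m} = A_{n+1}† A_{n+2}† ⋯ A_m†`, where `†` is the Hilbert space adjoint. -/
noncomputable def Params.opTheta (p : Params) (n m : ℕ) : Hilb p.L →ₗ.[ℂ] Hilb p.L :=
  opProd ((List.Ico (n + 1) (m + 1)).map fun k => (p.opA k).adjoint)

/-- The function `φ` is square integrable on `(0, L)`, lies in the domain of the operator `X`, and
its mean value `⟨X⟩_φ = ∫_0^L conj(φ) (X φ) dx` is `c`. -/
def HasMean {L : ℝ} (X : Hilb L →ₗ.[ℂ] Hilb L) (φ : ℝ → ℂ) (c : ℂ) : Prop :=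
  ∃ (hφ : MemLp φ 2 (mu L)) (hd : hφ.toLp φ ∈ X.domain), ⟪hφ.toLp φ, X ⟨hφ.toLp φ, hd⟩⟫_ℂ = c

/-! ### The constants -/

/-- The constant `𝓜(n, m)`, the nonnegative square root of
`∏_{k ≤ m} (n+m-k+1) (n+m+2ν+k+3) (1 + β² / ((k+ν+1) (n+m+ν+2))²)`. -/
noncomputable def Params.constM (p : Params) (n m : ℕ) : ℝ :=
  Real.sqrt (∏ k ∈ Finset.range (m + 1),
    ((n : ℝ) + m - k + 1) * (n + m + 2 * p.nu + k + 3) *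
      (1 + p.beta ^ 2 / ((k + p.nu + 1) * (n + m + p.nu + 2)) ^ 2))

/-- The constant
`𝓝(n, m) = ∏_{k ≤ m} (2n-k+1) (2n+2ν+k+3) (1 + β² / ((k+ν+1) (2n+ν+2))²)`. -/
noncomputable def Params.constN (p : Params) (n m : ℕ) : ℝ :=
  ∏ k ∈ Finset.range (m + 1),
    (2 * (n : ℝ) - k + 1) * (2 * n + 2 * p.nu + k + 3) *
      (1 + p.beta ^ 2 / ((k + p.nu + 1) * (2 * n + p.nu + 2)) ^ 2)

end PoschlTeller

/-! Put θ = πx/L, S = j+ν+1 and s = m+ν+1. Applying A_{m-1}⋯A_0 to φ_j gives a function sin^S θ ·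
exp(-βθ/S) · Q(cot θ) with Q a polynomial; S never changes along this chain. The superpotential is
W_m = -(ħπ/L)(s cot θ - β/s), so up to the factor ħπ/L the operator A_m and its formal adjoint act
on Q as `lowerPoly` and `raisePoly`. The Jacobi differential equation says that for m = 0 raising
after lowering multiplies Q by `energyGap`; shape invariance (`raisePoly_lowerPoly_succ`) carries
this to every m. It forces the degree to drop at each lowering, so Q is constant after j steps,
which yields the formula for W_j, and zero after j+1.

In the Hilbert space the normalized chain vectors e_m = `vec m j` satisfy A_m e_m = r_m e_{m+1} and
A_m† e_{m+1} = r_m e_m with r_m = √(2M(E_j - E_m)). The first relation is a computation. The second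
concerns the true adjoint of an operator on its maximal domain: the boundary terms must vanish
against every u in that domain. They do, because chain functions are O(sin θ) and a nonzero boundary
value would make 1/x integrable (`inner_eq_of_mem_graphA`). The two relations also give ‖e_m‖ = 1
for m ≤ j (`inner_vec`).

Λ and Θ therefore move along the chain with coefficient ∏ r_k, and their adjoints move back with the
same coefficient; density of the domains comes from test functions, which all A_m and A_m† preserve.
Each mean value is (∏ r_k)², a power of ħπ/L times a quotient of products of energy gaps. 𝓜² and 𝓝
are such products, on the levels j = n+m+1 and j = 2n+1. -/

namespace PoschlTeller

/-! ### Ladder operators on polynomials -/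

section Polynomials

open Polynomial

/-- The action of `d/dθ - (s cot θ - β / s)` on functions
`sin^S θ exp (-β θ / S) Q (cot θ)`, in terms of the polynomial `Q`. -/
noncomputable def lowerPoly (β S s : ℂ) (Q : ℂ[X]) : ℂ[X] :=
  (C (S - s) * X - C (β / S - β / s)) * Q - (1 + X ^ 2) * derivative Q

/-- The action of `-d/dθ - (s cot θ - β / s)` on functions
`sin^S θ exp (-β θ / S) R (cot θ)`, in terms of the polynomial `R`. -/
noncomputable def raisePoly (β S s : ℂ) (R : ℂ[X]) : ℂ[X] :=
  (1 + X ^ 2) * derivative R - (C (S + s) * X - C (β / S + β / s)) * R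

/-- The difference of the dimensionless energies `S² - β² / S²` and `s² - β² / s²`. -/
noncomputable def energyGap (β S s : ℂ) : ℂ := (S ^ 2 - (β / S) ^ 2) - (s ^ 2 - (β / s) ^ 2)

theorem lowerPoly_zero (β S s : ℂ) : lowerPoly β S s 0 = 0 := by simp [lowerPoly]

theorem raisePoly_zero (β S s : ℂ) : raisePoly β S s 0 = 0 := by simp [raisePoly]

theorem lowerPoly_C_mul (β S s c : ℂ) (Q : ℂ[X]) :
    lowerPoly β S s (C c * Q) = C c * lowerPoly β S s Q := by
  simp only [lowerPoly, derivative_mul, derivative_C]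
  ring

/-- Shape invariance. The β-terms match because s(β/s) and (s+1)(β/(s+1)) both equal β; the rest is
a polynomial identity. -/
theorem raisePoly_lowerPoly_succ (β S s : ℂ) (hs : s ≠ 0) (hs' : s + 1 ≠ 0) (R : ℂ[X]) :
    raisePoly β S (s + 1) (lowerPoly β S (s + 1) R) =
      lowerPoly β S s (raisePoly β S s R) +
        C (energyGap β S (s + 1) - energyGap β S s) * R := by
  have h : s * (β / s) = (s + 1) * (β / (s + 1)) := by field_simp
  have h' : (C s * C (β / s) : ℂ[X]) = (C s + 1) * C (β / (s + 1)) := by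
    rw [← C_mul, h, C_mul, C_add, C_1]
  simp only [raisePoly, lowerPoly, energyGap, derivative_mul, derivative_C, derivative_X,
    derivative_sub, derivative_add, derivative_one, derivative_X_pow, C_sub, C_add, C_pow, C_1]
  simp only [Nat.cast_ofNat, map_ofNat]
  linear_combination (2 * X * R) * h'

theorem raisePoly_lowerPoly_lowerPoly (β S s : ℂ) (hs : s ≠ 0) (hs' : s + 1 ≠ 0) (Q : ℂ[X])
    (hQ : raisePoly β S s (lowerPoly β S s Q) = C (energyGap β S s) * Q) :
    raisePoly β S (s + 1) (lowerPoly β S (s + 1) (lowerPoly β S s Q)) =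
      C (energyGap β S (s + 1)) * lowerPoly β S s Q := by
  rw [raisePoly_lowerPoly_succ β S s hs hs', hQ, lowerPoly_C_mul, C_sub]
  ring

theorem coeff_one_add_X_sq_mul_derivative (Q : ℂ[X]) (k : ℕ) :
    ((1 + X ^ 2) * derivative Q).coeff (k + 1) =
      Q.coeff (k + 2) * (k + 2) + Q.coeff k * k := by
  rw [add_mul, one_mul, coeff_add, coeff_derivative, pow_two, mul_assoc, coeff_X_mul]
  rcases k with _ | k
  · rw [mul_coeff_zero, coeff_X_zero]; push_cast; ring
  · rw [coeff_X_mul, coeff_derivative]; push_cast; ring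

theorem coeff_lowerPoly_succ (β S s : ℂ) (Q : ℂ[X]) (k : ℕ) :
    (lowerPoly β S s Q).coeff (k + 1) = (S - s - k) * Q.coeff k
      - (β / S - β / s) * Q.coeff (k + 1) - Q.coeff (k + 2) * (k + 2) := by
  rw [lowerPoly, coeff_sub, coeff_one_add_X_sq_mul_derivative, sub_mul, coeff_sub, mul_assoc,
    coeff_C_mul, coeff_C_mul, coeff_X_mul]
  ring

theorem coeff_raisePoly_succ (β S s : ℂ) (Q : ℂ[X]) (k : ℕ) :
    (raisePoly β S s Q).coeff (k + 1) = (k - (S + s)) * Q.coeff k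
      + (β / S + β / s) * Q.coeff (k + 1) + Q.coeff (k + 2) * (k + 2) := by
  rw [raisePoly, coeff_sub, coeff_one_add_X_sq_mul_derivative, sub_mul, coeff_sub, mul_assoc,
    coeff_C_mul, coeff_C_mul, coeff_X_mul]
  ring

/-- Lowering decreases the degree of an eigenvector. -/
theorem coeff_lowerPoly_eq_zero (β S s : ℂ) (hs : s ≠ 0) (d : ℕ) (hS : S = s + d) (Q : ℂ[X])
    (hQ : raisePoly β S s (lowerPoly β S s Q) = C (energyGap β S s) * Q)
    (hd : ∀ k, d < k → Q.coeff k = 0) (k : ℕ) (hk : d ≤ k) :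
    (lowerPoly β S s Q).coeff k = 0 := by
  have h1 : ∀ k, d < k → (lowerPoly β S s Q).coeff k = 0 := by
    intro k hk
    obtain ⟨k, rfl⟩ := Nat.exists_eq_succ_of_ne_zero (by omega : k ≠ 0)
    rw [Nat.succ_eq_add_one, coeff_lowerPoly_succ, hd (k + 1) (by omega), hd (k + 2) (by omega)]
    -- In degree d + 1 the only surviving term carries the factor S - s - d = 0.
    rcases eq_or_lt_of_le (by omega : d ≤ k) with rfl | hlt
    · rw [hS]; ring
    · rw [hd k hlt]; ring
  rcases eq_or_lt_of_le hk with rfl | hlt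
  · have h2 := congrArg (fun P => P.coeff (d + 1)) hQ
    simp only [coeff_raisePoly_succ, coeff_C_mul] at h2
    rw [h1 (d + 1) (by omega), h1 (d + 2) (by omega), hd (d + 1) (by omega), hS] at h2
    -- In degree d + 1 the eigenvalue equation has right side 0, and raising contributes d - (S + s)
    -- = -2s.
    have h3 : (-2 * s) * (lowerPoly β (s + d) s Q).coeff d = 0 := by linear_combination h2
    rw [hS]
    exact (mul_eq_zero.1 h3).resolve_left (mul_ne_zero (by norm_num) hs)
  · exact h1 k hlt

/-! ### Jacobi polynomials -/

/-- The coefficients of the Jacobi polynomial in powers of `(z - 1) / 2`. -/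
noncomputable def jacobiCoeff (n : ℕ) (a b : ℂ) (k : ℕ) : ℂ :=
  (ascPochhammer ℂ k).eval (n + a + b + 1) * (ascPochhammer ℂ (n - k)).eval (a + k + 1) /
    ((k.factorial : ℂ) * ((n - k).factorial : ℂ))

/-- The Jacobi polynomial as a polynomial in `(z - 1) / 2`. -/
noncomputable def jacobiPoly (n : ℕ) (a b : ℂ) : ℂ[X] :=
  ∑ k ∈ Finset.range (n + 1), C (jacobiCoeff n a b k) * X ^ k

theorem jacobi_eq_eval (n : ℕ) (a b z : ℂ) :
    jacobi n a b z = (jacobiPoly n a b).eval ((z - 1) / 2) := by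
  simp [jacobi, jacobiPoly, eval_finsetSum, jacobiCoeff]

theorem coeff_jacobiPoly (n : ℕ) (a b : ℂ) (k : ℕ) :
    (jacobiPoly n a b).coeff k = if k ≤ n then jacobiCoeff n a b k else 0 := by
  simp [jacobiPoly, coeff_C_mul, coeff_X_pow]

/-- The ratio of consecutive hypergeometric coefficients, cleared of denominators so that no
condition on a is needed; the factor n - k makes it hold at k = n too. -/
theorem coeff_jacobiPoly_succ (n : ℕ) (a b : ℂ) (k : ℕ) :
    (jacobiPoly n a b).coeff (k + 1) * (k + 1) * (k + a + 1) =
      (jacobiPoly n a b).coeff k * (n - k) * (k + n + a + b + 1) := by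
  rw [coeff_jacobiPoly, coeff_jacobiPoly]
  rcases lt_trichotomy k n with h | rfl | h
  · rw [if_pos (by omega), if_pos (by omega)]
    obtain ⟨r, rfl⟩ := Nat.exists_eq_add_of_lt h
    have e1 : k + r + 1 - (k + 1) = r := by omega
    have e2 : k + r + 1 - k = r + 1 := by omega
    have e3 : (ascPochhammer ℂ (r + 1)).eval (a + k + 1) =
        (a + k + 1) * (ascPochhammer ℂ r).eval (a + (k + 1 : ℕ) + 1) := by
      rw [ascPochhammer_succ_left, eval_mul, eval_X, eval_comp]
      simp only [eval_add, eval_X, eval_one]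
      push_cast
      ring_nf
    rw [jacobiCoeff, jacobiCoeff, e1, e2, e3, ascPochhammer_succ_eval, Nat.factorial_succ,
      Nat.factorial_succ]
    have h1 : (k.factorial : ℂ) ≠ 0 := Nat.cast_ne_zero.2 (Nat.factorial_ne_zero _)
    have h2 : (r.factorial : ℂ) ≠ 0 := Nat.cast_ne_zero.2 (Nat.factorial_ne_zero _)
    have h3 : (k : ℂ) + 1 ≠ 0 := by exact_mod_cast Nat.succ_ne_zero k
    have h4 : (r : ℂ) + 1 ≠ 0 := by exact_mod_cast Nat.succ_ne_zero r
    push_cast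
    field_simp
    ring
  · rw [if_neg (by omega)]; ring
  · rw [if_neg (by omega), if_neg (by omega)]; ring

/-- The hypergeometric form of the differential equation of the Jacobi polynomials. -/
theorem jacobiPoly_ode (n : ℕ) (a b : ℂ) :
    (X + X ^ 2) * derivative (derivative (jacobiPoly n a b)) +
      (C (a + 1) + C (a + b + 2) * X) * derivative (jacobiPoly n a b) =
        C (n * (n + a + b + 1)) * jacobiPoly n a b := by
  ext k
  have h := coeff_jacobiPoly_succ n a b k
  set J := jacobiPoly n a b
  have e1 : (X * derivative (derivative J)).coeff k = J.coeff (k + 1) * (k + 1) * k := by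
    rcases k with _ | k
    · simp
    · rw [coeff_X_mul, coeff_derivative, coeff_derivative]; push_cast; ring
  have e2 : (X * derivative J).coeff k = J.coeff k * k := by
    rcases k with _ | k
    · simp
    · rw [coeff_X_mul, coeff_derivative]; push_cast; ring
  have e3 : (X * (X * derivative (derivative J))).coeff k = J.coeff k * k * (k - 1) := by
    rcases k with _ | _ | k
    · simp
    · simp
    · rw [coeff_X_mul, coeff_X_mul, coeff_derivative, coeff_derivative]; push_cast; ring
  rw [add_mul, add_mul, pow_two, mul_assoc, mul_assoc, coeff_add, coeff_add, coeff_add,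
    coeff_C_mul, coeff_C_mul, coeff_C_mul, e1, e2, e3, coeff_derivative]
  linear_combination h

/-- The polynomial `Q` with `P_n^{(a, b)} (i c) = Q (c)`. -/
noncomputable def cotPoly (n : ℕ) (a b : ℂ) : ℂ[X] :=
  (jacobiPoly n a b).comp (C (Complex.I / 2) * X - C (1 / 2))

theorem eval_cotPoly (n : ℕ) (a b c : ℂ) :
    (cotPoly n a b).eval c = jacobi n a b (Complex.I * c) := by
  rw [jacobi_eq_eval, cotPoly, eval_comp]
  congr 1
  simp
  ring

theorem coeff_cotPoly_eq_zero (n : ℕ) (a b : ℂ) (k : ℕ) (hk : n < k) :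
    (cotPoly n a b).coeff k = 0 := by
  apply coeff_eq_zero_of_natDegree_lt
  refine lt_of_le_of_lt (natDegree_comp_le) ?_
  have h1 : (jacobiPoly n a b).natDegree ≤ n := by
    rw [natDegree_le_iff_coeff_eq_zero]
    intro N hN
    rw [coeff_jacobiPoly, if_neg (by omega)]
  have h2 : (C (Complex.I / 2) * X - C (1 / 2) : ℂ[X]).natDegree ≤ 1 := by
    compute_degree
  calc _ ≤ n * 1 := Nat.mul_le_mul h1 h2
    _ < k := by omega

/-- The leading coefficient of `jacobiPoly` is (n+a+b+1)_n / n!, whose zeros the hypothesis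
excludes; composition with a polynomial of degree one loses nothing. -/
theorem cotPoly_ne_zero (n : ℕ) (a b : ℂ) (h : ∀ k : ℕ, k < n → (n + a + b + 1 : ℂ) ≠ -k) :
    cotPoly n a b ≠ 0 := by
  have hJ : jacobiPoly n a b ≠ 0 := by
    intro h0
    have h1 := coeff_jacobiPoly n a b n
    rw [h0, if_pos le_rfl, jacobiCoeff, Nat.sub_self] at h1
    simp only [coeff_zero, ascPochhammer_zero, eval_one, mul_one] at h1
    have h2 : (n.factorial : ℂ) * ((0).factorial : ℂ) ≠ 0 := by
      simp [Nat.factorial_ne_zero]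
    have h3 := (div_eq_zero_iff.1 h1.symm).resolve_right h2
    obtain ⟨k, hk, hk'⟩ := (ascPochhammer_eval_eq_zero_iff n _).1 h3
    exact h k hk (by rw [hk', neg_neg])
  intro h0
  have hdeg : (C (Complex.I / 2) * X - C (1 / 2) : ℂ[X]).natDegree = 1 := by
    compute_degree!
  rcases comp_eq_zero_iff.1 h0 with h1 | ⟨-, h1⟩
  · exact hJ h1
  · rw [h1, natDegree_C] at hdeg
    exact zero_ne_one hdeg

/-- Substitution t = (ic - 1)/2 in the hypergeometric equation: t + t² = -(1 + c²)/4 and d²/dt² = -4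
d²/dc². -/
theorem cotPoly_ode (n : ℕ) (a b : ℂ) :
    (1 + X ^ 2) * derivative (derivative (cotPoly n a b)) +
      (C (-Complex.I * (a - b)) + C (a + b + 2) * X) * derivative (cotPoly n a b) =
        C (n * (n + a + b + 1)) * cotPoly n a b := by
  have h := congrArg (fun P => P.comp (C (Complex.I / 2) * X - C (1 / 2))) (jacobiPoly_ode n a b)
  simp only [add_comp, mul_comp, X_comp, pow_comp, C_comp] at h
  have hI : (C Complex.I * C Complex.I : ℂ[X]) = -1 := by
    rw [← C_mul, Complex.I_mul_I, C_neg, C_1]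
  have hl : (C (Complex.I / 2) : ℂ[X]) = C Complex.I * C (1 / 2) := by rw [← C_mul]; ring_nf
  have h2 : (2 * C (1 / 2) : ℂ[X]) = 1 := by
    rw [← C_1, ← map_ofNat C, ← C_mul]; norm_num
  simp only [cotPoly, derivative_comp, derivative_mul, derivative_sub, derivative_C, derivative_X,
    zero_mul, mul_one, zero_add, sub_zero]
  rw [← h, hl]
  simp only [C_add, C_mul, C_neg, C_sub, C_1, map_ofNat]
  set J1 := (derivative (jacobiPoly n a b)).comp (C Complex.I * C (1 / 2) * X - C (1 / 2))
  set J2 := (derivative (derivative (jacobiPoly n a b))).comp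
    (C Complex.I * C (1 / 2) * X - C (1 / 2))
  set i : ℂ[X] := C Complex.I
  set u : ℂ[X] := C (1 / 2)
  linear_combination (J2 * u ^ 2 - J1 * u * (C a - C b)) * hI +
    (J2 * (i * u * X - u) + J1 * (C a + 1)) * h2

/-- The start of the induction along the chain. With S = s + n one has a + b = -2S and -i(a - b) =
2β/S, and the eigenvalue equation becomes -(1 + X²) times the differential equation. -/
theorem raisePoly_lowerPoly_cotPoly (n : ℕ) (β s : ℂ) (a b : ℂ) (hs : s ≠ 0) (hS : s + n ≠ 0)
    (ha : a = -(s + n) + Complex.I * (β / (s + n)))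
    (hb : b = -(s + n) - Complex.I * (β / (s + n))) :
    raisePoly β (s + n) s (lowerPoly β (s + n) s (cotPoly n a b)) =
      C (energyGap β (s + n) s) * cotPoly n a b := by
  have h := cotPoly_ode n a b
  have e1 : -Complex.I * (a - b) = 2 * (β / (s + n)) := by
    rw [ha, hb]; linear_combination (-2 * (β / (s + n))) * Complex.I_sq
  have e2 : a + b = -2 * (s + n) := by rw [ha, hb]; ring
  have e3 : (n : ℂ) * (n + a + b + 1) = -n * (2 * s + n - 1) := by linear_combination n * e2
  have e4 : a + b + 2 = 2 - 2 * (s + n) := by rw [e2]; ring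
  rw [e1, e4, e3] at h
  have h1 : s * (β / s) = (s + n) * (β / (s + n)) := by field_simp
  have h' : (C s * C (β / s) : ℂ[X]) = (C s + C (n : ℂ)) * C (β / (s + n)) := by
    rw [← C_mul, h1, C_mul, C_add]
  simp only [raisePoly, lowerPoly, energyGap, derivative_mul, derivative_C, derivative_X,
    derivative_sub, derivative_add, derivative_one, derivative_X_pow, C_sub, C_add, C_pow, C_1,
    C_mul, C_neg] at h ⊢
  simp only [Nat.cast_ofNat, map_ofNat] at h ⊢
  linear_combination (-(1 + X ^ 2)) * h + (-2 * X * cotPoly n a b) * h'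

end Polynomials

/-! ### Graphs of products and adjoints -/

section Graphs

variable {L : ℝ}

/-- Passing to graphs removes the nested domain conditions of `opMul` from all later arguments. -/
theorem mem_graph_opMul {S T : Hilb L →ₗ.[ℂ] Hilb L} {u w : Hilb L} :
    (u, w) ∈ (opMul S T).graph ↔ ∃ v, (u, v) ∈ T.graph ∧ (v, w) ∈ S.graph := by
  constructor
  · intro h
    obtain ⟨⟨x, hx⟩, rfl, rfl⟩ := (LinearPMap.mem_graph_iff _).1 h
    obtain ⟨⟨y, hy, hyx⟩, hT⟩ := id hx
    have hval : T.domRestrict ((S.domain.comap T.toFun).map T.domain.subtype)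
        ⟨x, ⟨⟨y, hy, hyx⟩, hT⟩⟩ = T y := LinearPMap.domRestrict_apply hyx.symm
    refine ⟨T y, ?_, ?_⟩
    · exact (LinearPMap.mem_graph_iff _).2 ⟨y, hyx, rfl⟩
    · refine (LinearPMap.mem_graph_iff _).2 ⟨⟨T y, hy⟩, rfl, ?_⟩
      exact congrArg S (Subtype.ext hval.symm)
  · rintro ⟨v, h1, h2⟩
    obtain ⟨x, rfl, rfl⟩ := (LinearPMap.mem_graph_iff _).1 h1
    obtain ⟨y, hy, rfl⟩ := (LinearPMap.mem_graph_iff _).1 h2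
    have hy' : (y : Hilb L) = T x := hy
    have hS : T x ∈ S.domain := hy' ▸ y.2
    have hx : (x : Hilb L) ∈ (opMul S T).domain := ⟨⟨x, hS, rfl⟩, x.2⟩
    have hval : T.domRestrict ((S.domain.comap T.toFun).map T.domain.subtype)
        ⟨x, hx⟩ = T x := LinearPMap.domRestrict_apply rfl
    refine (LinearPMap.mem_graph_iff _).2 ⟨⟨x, hx⟩, rfl, ?_⟩
    exact congrArg S (Subtype.ext (hval.trans hy.symm))

theorem mem_graph_opProd_nil {u w : Hilb L} :
    (u, w) ∈ (opProd ([] : List (Hilb L →ₗ.[ℂ] Hilb L))).graph ↔ u = w := by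
  rw [LinearPMap.mem_graph_iff]
  constructor
  · rintro ⟨x, rfl, h⟩
    exact h
  · rintro rfl
    exact ⟨⟨u, trivial⟩, rfl, rfl⟩

/-- `z` satisfies the relation that defines `T† y`. -/
def IsAdjointPair (T : Hilb L →ₗ.[ℂ] Hilb L) (y z : Hilb L) : Prop :=
  ∀ u v, (u, v) ∈ T.graph → ⟪v, y⟫_ℂ = ⟪u, z⟫_ℂ

theorem mem_graph_adjoint {T : Hilb L →ₗ.[ℂ] Hilb L} (hT : Dense (T.domain : Set (Hilb L)))
    {y z : Hilb L} : (y, z) ∈ T.adjoint.graph ↔ IsAdjointPair T y z := by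
  rw [LinearPMap.adjoint_graph_eq_graph_adjoint hT, Submodule.mem_adjoint_iff]
  simp only [sub_eq_zero, IsAdjointPair]

/-- The inclusion of T in T††, used for the adjoint of Θ, whose factors are already adjoints. -/
theorem isAdjointPair_adjoint {T : Hilb L →ₗ.[ℂ] Hilb L} (hT : Dense (T.domain : Set (Hilb L)))
    {u v : Hilb L} (h : (u, v) ∈ T.graph) : IsAdjointPair T.adjoint u v := by
  intro y z hyz
  have h1 := (mem_graph_adjoint hT).1 hyz u v h
  rw [← inner_conj_symm, ← h1, inner_conj_symm]

theorem IsAdjointPair.smul {T : Hilb L →ₗ.[ℂ] Hilb L} {y z : Hilb L} (h : IsAdjointPair T y z)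
    (c : ℂ) : IsAdjointPair T (c • y) (c • z) := by
  intro u v huv
  rw [inner_smul_right, inner_smul_right, h u v huv]

/-- The inclusion T†S† ⊆ (ST)†. As a relation it needs no density; density matters only when a pair
is turned into a point of the graph of the adjoint. -/
theorem IsAdjointPair.opMul {S T : Hilb L →ₗ.[ℂ] Hilb L} {x y z : Hilb L}
    (hS : IsAdjointPair S x y) (hT : IsAdjointPair T y z) :
    IsAdjointPair (opMul S T) x z := by
  intro u w h
  obtain ⟨v, h1, h2⟩ := mem_graph_opMul.1 h
  rw [hS v w h2, hT u v h1]

theorem smul_mem_graph {T : Hilb L →ₗ.[ℂ] Hilb L} {u v : Hilb L} (h : (u, v) ∈ T.graph) (c : ℂ) :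
    (c • u, c • v) ∈ T.graph := T.graph.smul_mem c h

variable (T : ℕ → Hilb L →ₗ.[ℂ] Hilb L) (e : ℕ → Hilb L) (r : ℕ → ℂ)

theorem mem_graph_opProd_reverse (h : ∀ k, (e k, r k • e (k + 1)) ∈ (T k).graph) {a b : ℕ}
    (hab : a ≤ b) :
    (e a, (∏ k ∈ Finset.Ico a b, r k) • e b) ∈
      (opProd ((List.Ico a b).reverse.map T)).graph := by
  induction b, hab using Nat.le_induction with
  | base => rw [List.Ico.self_empty]; exact mem_graph_opProd_nil.2 (by simp)
  | succ b hab ih =>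
    rw [List.Ico.succ_top hab, List.reverse_append, List.reverse_singleton, List.singleton_append,
      List.map_cons, opProd, mem_graph_opMul]
    refine ⟨_, ih, ?_⟩
    rw [Finset.prod_Ico_succ_top hab, mul_smul]
    exact smul_mem_graph (h b) _

/-- The factor applied last has the lowest index here, so the induction runs downwards in a; for the
reversed product it runs upwards in b. -/
theorem mem_graph_opProd (h : ∀ k, (e (k + 1), r k • e k) ∈ (T k).graph) {a b : ℕ}
    (hab : a ≤ b) :
    (e b, (∏ k ∈ Finset.Ico a b, r k) • e a) ∈ (opProd ((List.Ico a b).map T)).graph := by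
  induction hab using Nat.decreasingInduction with
  | self => rw [List.Ico.self_empty]; exact mem_graph_opProd_nil.2 (by simp)
  | of_succ a hab ih =>
    rw [List.Ico.eq_cons hab, List.map_cons, opProd, mem_graph_opMul]
    refine ⟨_, ih, ?_⟩
    rw [Finset.prod_eq_prod_Ico_succ_bot hab,
      mul_comm, mul_smul]
    exact smul_mem_graph (h a) _

theorem isAdjointPair_opProd_reverse (h : ∀ k, IsAdjointPair (T k) (e (k + 1)) (r k • e k))
    {a b : ℕ} (hab : a ≤ b) :
    IsAdjointPair (opProd ((List.Ico a b).reverse.map T)) (e b)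
      ((∏ k ∈ Finset.Ico a b, r k) • e a) := by
  induction b, hab using Nat.le_induction with
  | base =>
    intro u v huv
    simp only [List.Ico.self_empty, List.reverse_nil, List.map_nil, mem_graph_opProd_nil] at huv
    simp [huv]
  | succ b hab ih =>
    rw [List.Ico.succ_top hab, List.reverse_append, List.reverse_singleton, List.singleton_append,
      List.map_cons, opProd, Finset.prod_Ico_succ_top hab, mul_comm, mul_smul]
    exact (h b).opMul (ih.smul _)

theorem isAdjointPair_opProd (h : ∀ k, IsAdjointPair (T k) (e k) (r k • e (k + 1)))
    {a b : ℕ} (hab : a ≤ b) :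
    IsAdjointPair (opProd ((List.Ico a b).map T)) (e a)
      ((∏ k ∈ Finset.Ico a b, r k) • e b) := by
  induction hab using Nat.decreasingInduction with
  | self =>
    intro u v huv
    simp only [List.Ico.self_empty, List.map_nil, mem_graph_opProd_nil] at huv
    simp [huv]
  | of_succ a hab ih =>
    rw [List.Ico.eq_cons hab, List.map_cons, opProd, Finset.prod_eq_prod_Ico_succ_bot hab,
      mul_comm, mul_smul]
    have := (h a).opMul (ih.smul (r a))
    rwa [smul_comm] at this

/-- A set that is invariant under all factors lies in the domain of their product. -/
theorem exists_mem_graph_opProd {D : Set (Hilb L)} (l : List (Hilb L →ₗ.[ℂ] Hilb L))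
    (h : ∀ S ∈ l, ∀ u ∈ D, ∃ v ∈ D, (u, v) ∈ S.graph) {u : Hilb L} (hu : u ∈ D) :
    ∃ v ∈ D, (u, v) ∈ (opProd l).graph := by
  induction l with
  | nil => exact ⟨u, hu, mem_graph_opProd_nil.2 rfl⟩
  | cons S l ih =>
    obtain ⟨v, hv, h1⟩ := ih fun S hS => h S (List.mem_cons_of_mem _ hS)
    obtain ⟨w, hw, h2⟩ := h S List.mem_cons_self v hv
    exact ⟨w, hw, mem_graph_opMul.2 ⟨v, h1, h2⟩⟩

theorem mem_domain_opProd {D : Set (Hilb L)} (l : List (Hilb L →ₗ.[ℂ] Hilb L))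
    (h : ∀ S ∈ l, ∀ u ∈ D, ∃ v ∈ D, (u, v) ∈ S.graph) :
    D ⊆ (opProd l).domain := fun _ hu =>
  let ⟨_, _, h1⟩ := exists_mem_graph_opProd l h hu
  LinearPMap.mem_domain_of_mem_graph h1

theorem mem_graph_opA (p : Params) (m : ℕ) (q : Hilb p.L × Hilb p.L) :
    q ∈ (p.opA m).graph ↔ q ∈ graphA p.L p.hbar (p.superpot m) := by
  rw [Params.opA, Submodule.toLinearPMap_graph_eq]
  exact fun x hx h0 => graphA_snd_eq_zero _ _ _ x hx h0

/-- The mean value, from a value of the operator. -/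
theorem hasMean_of_mem_graph {X : Hilb L →ₗ.[ℂ] Hilb L} {φ : ℝ → ℂ} {c : ℂ}
    (hφ : MemLp φ 2 (mu L)) {w : Hilb L} (h : (hφ.toLp φ, w) ∈ X.graph)
    (hc : ⟪hφ.toLp φ, w⟫_ℂ = c) : HasMean X φ c := by
  have hd := LinearPMap.mem_domain_of_mem_graph h
  refine ⟨hφ, hd, ?_⟩
  rw [← (LinearPMap.image_iff hd).2 h, hc]

end Graphs

/-! ### Integration by parts -/

section IntegrationByParts

open Set Filter Topology

variable {L : ℝ}

theorem HasACDeriv.conj {f g : ℝ → ℂ} (h : HasACDeriv L f g) :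
    HasACDeriv L (fun x => starRingEnd ℂ (f x)) (fun x => starRingEnd ℂ (g x)) := by
  intro a ha b hb
  obtain ⟨h1, h2⟩ := h a ha b hb
  have h3 := (Complex.conjCLE : ℂ →L[ℝ] ℂ).intervalIntegral_comp_comm h1
  refine ⟨?_, ?_⟩
  · rw [intervalIntegrable_iff] at h1 ⊢
    exact (Complex.conjCLE : ℂ →L[ℝ] ℂ).integrable_comp h1
  · rw [← map_sub, h2]
    exact h3.symm

/-- The real and imaginary parts are treated separately and recombined with the constants 1 and i.
-/
theorem absolutelyContinuousOnInterval_primitive {g : ℝ → ℂ} (hg : Integrable g) (a b : ℝ) :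
    AbsolutelyContinuousOnInterval (fun x => ∫ t in a..x, g t) a b := by
  have hone : AbsolutelyContinuousOnInterval (fun _ => (1 : ℂ)) a b :=
    (contDiffOn_const (𝕜 := ℝ)).absolutelyContinuousOnInterval
  have hI : AbsolutelyContinuousOnInterval (fun _ => Complex.I) a b :=
    (contDiffOn_const (𝕜 := ℝ)).absolutelyContinuousOnInterval
  have hre := (hg.re.intervalIntegrable
    (a := a) (b := b)).absolutelyContinuousOnInterval_intervalIntegral (c := a) left_mem_uIcc
  have him := (hg.im.intervalIntegrable
    (a := a) (b := b)).absolutelyContinuousOnInterval_intervalIntegral (c := a) left_mem_uIcc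
  have h := (hre.smul hone).add (him.smul hI)
  have heq : (fun x => ∫ t in a..x, g t) =
      ((fun x => ∫ t in a..x, RCLike.re (g t)) • fun _ => (1 : ℂ))
      + ((fun x => ∫ t in a..x, RCLike.im (g t)) • fun _ => Complex.I) := by
    funext x
    have e1 := Complex.reCLM.intervalIntegral_comp_comm (hg.intervalIntegrable (a := a) (b := x))
    have e2 := Complex.imCLM.intervalIntegral_comp_comm (hg.intervalIntegrable (a := a) (b := x))
    simp only [Complex.reCLM_apply, Complex.imCLM_apply] at e1 e2
    simp only [Pi.add_apply, Pi.smul_apply', Complex.real_smul, RCLike.re_to_complex,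
      RCLike.im_to_complex, e1, e2, mul_one]
    exact (Complex.re_add_im _).symm
  rw [heq]
  exact h

/-- A function that is absolutely continuous with almost everywhere derivative `g` is the
integral of `g`. -/
theorem integral_eq_sub_of_ae_hasDerivAt {f g : ℝ → ℂ} {a b : ℝ}
    (hf : AbsolutelyContinuousOnInterval f a b) (hg : IntervalIntegrable g volume a b)
    (hd : ∀ᵐ x, x ∈ uIoc a b → HasDerivAt f (g x) x) : ∫ x in a..b, g x = f b - f a := by
  -- Cutting g off makes it integrable on the whole line without changing its integral from a to b.
  set g' := (uIoc a b).indicator g with hg'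
  have hgi : Integrable g' := (integrable_indicator_iff measurableSet_uIoc).2
    (intervalIntegrable_iff.1 hg)
  have hP := absolutelyContinuousOnInterval_primitive hgi a b
  have hint : ∫ x in a..b, g' x = ∫ x in a..b, g x := by
    apply intervalIntegral.integral_congr_ae
    exact Eventually.of_forall fun x hx => indicator_of_mem hx _
  have hnull : ∀ᵐ x : ℝ, x ≠ a ∧ x ≠ b := by
    have h1 : ∀ᵐ x : ℝ, x ≠ a := by simp [ae_iff]
    have h2 : ∀ᵐ x : ℝ, x ≠ b := by simp [ae_iff]
    exact h1.and h2
  -- The difference of f and the primitive is absolutely continuous with derivative zero almost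
  -- everywhere, hence constant.
  obtain ⟨C, hC⟩ := (hf.sub hP).const_of_ae_hasDerivAt_zero (by
    filter_upwards [hd, (hgi.intervalIntegrable (a := a) (b := b)).ae_hasDerivAt_integral, hnull]
      with x h1 h2 h3 hx
    have hx' : x ∈ uIoc a b := by
      rw [mem_uIoc]
      rcases mem_uIcc.1 hx with h | h
      · exact Or.inl ⟨lt_of_le_of_ne h.1 h3.1.symm, h.2⟩
      · exact Or.inr ⟨lt_of_le_of_ne h.1 h3.2.symm, h.2⟩
    have h4 := (h1 hx').sub (h2 hx a left_mem_uIcc)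
    rwa [hg', indicator_of_mem hx', sub_self] at h4)
  have ha := hC a left_mem_uIcc
  have hb := hC b right_mem_uIcc
  simp only [Pi.sub_apply, intervalIntegral.integral_same, sub_zero] at ha hb
  rw [← hint, ha, ← hb]
  ring

theorem HasACDeriv.continuousOn {f g : ℝ → ℂ} (h : HasACDeriv L f g) :
    ContinuousOn f (Ioo 0 L) := by
  intro x hx
  obtain ⟨a, ha⟩ := exists_between hx.1
  obtain ⟨b, hb⟩ := exists_between hx.2
  have ha' : a ∈ Ioo 0 L := ⟨ha.1, ha.2.trans hx.2⟩
  have hb' : b ∈ Ioo 0 L := ⟨hx.1.trans hb.1, hb.2⟩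
  have hab : a < b := ha.2.trans hb.1
  have h1 := intervalIntegral.continuousOn_primitive_interval' (h a ha' b hb').1 left_mem_uIcc
  have hnhds : uIcc a b ∈ 𝓝 x := by
    rw [uIcc_of_le hab.le]
    exact Icc_mem_nhds ha.2 hb.1
  have h2 : ContinuousAt (fun y => f a + ∫ t in a..y, g t) x :=
    continuousAt_const.add (h1.continuousAt hnhds)
  refine (h2.congr ?_).continuousWithinAt
  filter_upwards [isOpen_Ioo.mem_nhds hx] with y hy
  rw [← (h a ha' y hy).2]
  ring

/-- Product rule, for an absolutely continuous and a continuously differentiable factor. -/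
theorem HasACDeriv.mul {f g G G' : ℝ → ℂ} (h : HasACDeriv L f g)
    (hG : ∀ x ∈ Ioo 0 L, HasDerivAt G (G' x) x) (hG' : ContinuousOn G' (Ioo 0 L)) :
    HasACDeriv L (fun x => f x * G x) (fun x => g x * G x + f x * G' x) := by
  intro a ha b hb
  have hsub : uIcc a b ⊆ Ioo 0 L := ordConnected_Ioo.uIcc_subset ha hb
  have hGc : ContinuousOn G (uIcc a b) :=
    fun x hx => (hG x (hsub hx)).continuousAt.continuousWithinAt
  have hfc := h.continuousOn.mono hsub
  have hgi := (h a ha b hb).1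
  have hint : IntervalIntegrable (fun x => g x * G x + f x * G' x) volume a b :=
    (hgi.mul_continuousOn hGc).add (hfc.mul (hG'.mono hsub)).intervalIntegrable
  refine ⟨hint, ?_⟩
  set g' := (uIoc a b).indicator g with hg'
  have hgi' : Integrable g' := (integrable_indicator_iff measurableSet_uIoc).2
    (intervalIntegrable_iff.1 hgi)
  have hF : ∀ x ∈ uIcc a b, f a + ∫ t in a..x, g' t = f x := by
    intro x hx
    have h3 : ∫ t in a..x, g' t = ∫ t in a..x, g t := by
      apply intervalIntegral.integral_congr_ae
      refine Eventually.of_forall fun t ht => indicator_of_mem ?_ _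
      exact uIoc_subset_uIoc_of_uIcc_subset_uIcc (uIcc_subset_uIcc left_mem_uIcc hx) ht
    rw [h3, ← (h a ha x (hsub hx)).2]
    ring
  have hFac : AbsolutelyContinuousOnInterval (fun x => f a + ∫ t in a..x, g' t) a b :=
    (contDiffOn_const (𝕜 := ℝ)).absolutelyContinuousOnInterval.add
      (absolutelyContinuousOnInterval_primitive hgi' a b)
  -- A bound for G' on the compact interval makes G Lipschitz there, hence absolutely continuous.
  obtain ⟨K, hK⟩ := isCompact_uIcc.exists_bound_of_continuousOn (hG'.mono hsub)
  have hGac : AbsolutelyContinuousOnInterval G a b := by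
    refine LipschitzOnWith.absolutelyContinuousOnInterval (K := K.toNNReal) ?_
    refine (convex_uIcc a b).lipschitzOnWith_of_nnnorm_hasDerivWithin_le (f' := G')
      (fun x hx => (hG x (hsub hx)).hasDerivWithinAt) fun x hx => ?_
    rw [← NNReal.coe_le_coe, coe_nnnorm]
    exact (hK x hx).trans (Real.le_coe_toNNReal K)
  have key := integral_eq_sub_of_ae_hasDerivAt (hFac.smul hGac) hint (by
    filter_upwards [(hgi'.intervalIntegrable (a := a) (b := b)).ae_hasDerivAt_integral] with x h1 hx
    have hx' := uIoc_subset_uIcc hx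
    have h2 := ((h1 hx' a left_mem_uIcc).const_add (f a)).mul (hG x (hsub hx'))
    rwa [hF x hx', hg', indicator_of_mem hx] at h2)
  rw [key]
  simp only [Pi.smul_apply', smul_eq_mul, hF a left_mem_uIcc, hF b right_mem_uIcc]

/-- If l ≠ 0, then x k(x) exceeds ‖l‖/2 near 0, so k dominates a multiple of 1/x, which is not
integrable. No pointwise control of k is needed. -/
theorem eq_zero_of_tendsto_of_norm_le_mul {Φ : ℝ → ℂ} {l : ℂ} {k : ℝ → ℝ} (hL : 0 < L)
    (hΦ : Tendsto Φ (𝓝[>] 0) (𝓝 l)) (hb : ∀ x ∈ Ioo 0 L, ‖Φ x‖ ≤ x * k x)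
    (hk : IntegrableOn k (Ioo 0 L)) : l = 0 := by
  by_contra hl
  have hl' : 0 < ‖l‖ := norm_pos_iff.2 hl
  have h1 : ∀ᶠ x in 𝓝[>] (0 : ℝ), ‖l‖ / 2 < ‖Φ x‖ :=
    hΦ.norm.eventually (lt_mem_nhds (by linarith))
  obtain ⟨η, hη, hη'⟩ := mem_nhdsGT_iff_exists_Ioo_subset.1 h1
  have hη0 : (0 : ℝ) < η := hη
  set δ := min η L with hδ
  have hδ0 : 0 < δ := lt_min hη0 hL
  have hsub : Ioo 0 δ ⊆ Ioo 0 L := Ioo_subset_Ioo_right (min_le_right _ _)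
  have h2 : IntegrableOn (fun x : ℝ => x⁻¹) (Ioo 0 δ) := by
    refine Integrable.mono' ((hk.mono_set hsub).const_mul (2 / ‖l‖))
      measurable_inv.aestronglyMeasurable ?_
    refine (ae_restrict_iff' measurableSet_Ioo).2 (Eventually.of_forall fun x hx => ?_)
    have h3 : ‖l‖ / 2 < ‖Φ x‖ := hη' ⟨hx.1, hx.2.trans_le (min_le_left _ _)⟩
    have h4 := h3.trans_le (hb x (hsub hx))
    have hx0 : 0 < x := hx.1
    rw [Real.norm_of_nonneg (inv_nonneg.2 hx0.le), inv_le_iff_one_le_mul₀ hx0, div_mul_eq_mul_div,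
      div_mul_eq_mul_div, le_div_iff₀ hl']
    linarith
  have h3 : IntervalIntegrable (fun x : ℝ => x⁻¹) volume 0 δ := by
    rw [intervalIntegrable_iff_integrableOn_Ioo_of_le hδ0.le]
    exact h2
  rcases intervalIntegrable_inv_iff.1 h3 with h | h
  · exact hδ0.ne h
  · exact h left_mem_uIcc

/-- The derivative of a function that vanishes at the end points, in a weak sense,
has integral zero. -/
theorem HasACDeriv.integral_eq_zero {Φ w : ℝ → ℂ} {k : ℝ → ℝ} (hL : 0 < L)
    (h : HasACDeriv L Φ w) (hw : IntegrableOn w (Ioo 0 L)) (hk : IntegrableOn k (Ioo 0 L))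
    (hb : ∀ x ∈ Ioo 0 L, ‖Φ x‖ ≤ x * k x) (hb' : ∀ x ∈ Ioo 0 L, ‖Φ x‖ ≤ (L - x) * k x) :
    ∫ x in Ioo 0 L, w x = 0 := by
  have hwi : IntervalIntegrable w volume 0 L :=
    (intervalIntegrable_iff_integrableOn_Ioo_of_le hL.le).2 hw
  set P := fun x => ∫ t in (0 : ℝ)..x, w t with hP
  have hPc : ContinuousOn P (Icc 0 L) := by
    have := intervalIntegral.continuousOn_primitive_interval' hwi left_mem_uIcc
    rwa [uIcc_of_le hL.le] at this
  have hc : L / 2 ∈ Ioo 0 L := ⟨by linarith, by linarith⟩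
  -- Φ differs from the primitive P by a constant, so it has a limit at each end point. Both limits
  -- are 0, whence P(L) = P(0).
  have hΦ : ∀ x ∈ Ioo 0 L, Φ x = Φ (L / 2) - P (L / 2) + P x := by
    intro x hx
    have h1 := (h _ hc x hx).2
    have h2 : P (L / 2) + ∫ t in (L / 2)..x, w t = P x := by
      apply intervalIntegral.integral_add_adjacent_intervals
      · exact hwi.mono_set (by
          rw [uIcc_of_le hc.1.le, uIcc_of_le hL.le]; exact Icc_subset_Icc_right hc.2.le)
      · exact (h _ hc x hx).1
    rw [← h1] at h2
    rw [← h2]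
    ring
  have h0 : Φ (L / 2) - P (L / 2) + P 0 = 0 := by
    refine eq_zero_of_tendsto_of_norm_le_mul hL ?_ hb hk
    have h1 : Tendsto P (𝓝[>] 0) (𝓝 (P 0)) := by
      have := (hPc 0 ⟨le_rfl, hL.le⟩).mono Ioo_subset_Icc_self
      rwa [ContinuousWithinAt, nhdsWithin_Ioo_eq_nhdsGT hL] at this
    refine (h1.const_add (Φ (L / 2) - P (L / 2))).congr' ?_
    filter_upwards [Ioo_mem_nhdsGT hL] with x hx
    exact (hΦ x hx).symm
  have h1 : Φ (L / 2) - P (L / 2) + P L = 0 := by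
    -- The right end point is reduced to the left one by the reflection x ↦ L - x.
    have hrefl : ∀ x ∈ Ioo 0 L, L - x ∈ Ioo 0 L := fun x hx =>
      ⟨by linarith [hx.2], by linarith [hx.1]⟩
    have hk' : IntegrableOn (fun x => k (L - x)) (Ioo 0 L) := by
      rw [← intervalIntegrable_iff_integrableOn_Ioo_of_le hL.le] at hk ⊢
      have := hk.comp_sub_left L
      simp only [sub_zero, sub_self] at this
      exact this.symm
    refine eq_zero_of_tendsto_of_norm_le_mul (Φ := fun x => Φ (L - x)) hL ?_ (fun x hx => ?_) hk'
    · have h2 : Tendsto P (𝓝[<] L) (𝓝 (P L)) := by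
        have := (hPc L ⟨hL.le, le_rfl⟩).mono Ioo_subset_Icc_self
        rwa [ContinuousWithinAt, nhdsWithin_Ioo_eq_nhdsLT hL] at this
      have h3 : Tendsto (fun x => L - x) (𝓝[>] 0) (𝓝[<] L) := by
        refine tendsto_nhdsWithin_iff.2 ⟨?_, ?_⟩
        · have : ContinuousAt (fun x => L - x) 0 := by fun_prop
          have h4 := this.tendsto
          rw [sub_zero] at h4
          exact h4.mono_left nhdsWithin_le_nhds
        · filter_upwards [self_mem_nhdsWithin] with x hx
          exact sub_lt_self L hx
      refine ((h2.comp h3).const_add (Φ (L / 2) - P (L / 2))).congr' ?_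
      filter_upwards [Ioo_mem_nhdsGT hL] with x hx
      exact (hΦ _ (hrefl x hx)).symm
    · have := hb' _ (hrefl x hx)
      rwa [sub_sub_cancel] at this
  have h2 : P L = P 0 := by linear_combination h1 - h0
  rw [← integral_Ioc_eq_integral_Ioo, ← intervalIntegral.integral_of_le hL.le]
  simpa [hP] using h2

instance isFiniteMeasure_mu : IsFiniteMeasure (mu L) := by
  unfold mu; infer_instance

/-- The formal adjoint of `ħ d/dx + W`, on functions that decay linearly at both end points. -/
theorem inner_eq_of_mem_graphA {hbar : ℝ} {W : ℝ → ℂ} (hL : 0 < L) (hbar0 : hbar ≠ 0)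
    (hW : ∀ x ∈ Ioo 0 L, starRingEnd ℂ (W x) = W x) {G G' : ℝ → ℂ} {C : ℝ}
    (hG : ∀ x ∈ Ioo 0 L, HasDerivAt G (G' x) x) (hG' : ContinuousOn G' (Ioo 0 L))
    (hb : ∀ x ∈ Ioo 0 L, ‖G x‖ ≤ C * x) (hb' : ∀ x ∈ Ioo 0 L, ‖G x‖ ≤ C * (L - x))
    {u v y z : Hilb L} (huv : (u, v) ∈ graphA L hbar W) (hy : y =ᵐ[mu L] G)
    (hz : z =ᵐ[mu L] fun x => -(hbar : ℂ) * G' x + W x * G x) : ⟪v, y⟫_ℂ = ⟪u, z⟫_ℂ := by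
  obtain ⟨f, g, hfg, hu, hv⟩ := huv
  simp only at hu hv
  have hΦ := hfg.conj.mul hG hG'
  set w : ℝ → ℂ := fun x => starRingEnd ℂ (g x) * G x + starRingEnd ℂ (f x) * G' x with hw
  have hmem : ∀ᵐ x ∂(mu L), x ∈ Ioo 0 L := ae_restrict_mem measurableSet_Ioo
  -- The W-terms cancel because W is real; what remains is ħ times the derivative of conj(f) G.
  have hae : (fun x => ⟪v x, y x⟫_ℂ - ⟪u x, z x⟫_ℂ) =ᵐ[mu L] fun x => (hbar : ℂ) * w x := by
    filter_upwards [hu, hv, hy, hz, hmem] with x h1 h2 h3 h4 h5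
    rw [h1, h2, h3, h4, RCLike.inner_apply, RCLike.inner_apply, map_add, map_mul, map_mul, hW x h5,
      Complex.conj_ofReal, hw]
    ring
  have hi1 := L2.integrable_inner (𝕜 := ℂ) v y
  have hi2 := L2.integrable_inner (𝕜 := ℂ) u z
  -- Nothing is known about g alone near the end points; integrability of w is read off from the two
  -- L² pairings.
  have hwi : IntegrableOn w (Ioo 0 L) := by
    have h1 := ((hi1.sub hi2).congr hae).const_mul ((hbar : ℂ)⁻¹)
    refine Integrable.congr h1 (Eventually.of_forall fun x => ?_)
    exact inv_mul_cancel_left₀ (Complex.ofReal_ne_zero.2 hbar0) _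
  have hfi : Integrable (fun x => C * ‖f x‖) (mu L) := by
    have h1 : Integrable u (mu L) := (Lp.memLp u).integrable one_le_two
    exact ((h1.congr hu).norm).const_mul C
  have h0 := hΦ.integral_eq_zero hL hwi hfi
    (fun x hx => by
      rw [norm_mul, RCLike.norm_conj]
      nlinarith [hb x hx, norm_nonneg (f x)])
    (fun x hx => by
      rw [norm_mul, RCLike.norm_conj]
      nlinarith [hb' x hx, norm_nonneg (f x)])
  rw [← sub_eq_zero, L2.inner_def, L2.inner_def, ← integral_sub hi1 hi2, integral_congr_ae hae,
    integral_const_mul]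
  have h1 : ∫ x, w x ∂(mu L) = 0 := h0
  rw [h1, mul_zero]

theorem hasACDeriv_of_hasDerivAt {G G' : ℝ → ℂ} (hG : ∀ x ∈ Ioo 0 L, HasDerivAt G (G' x) x)
    (hG' : ContinuousOn G' (Ioo 0 L)) : HasACDeriv L G G' := by
  intro a ha b hb
  have hsub : uIcc a b ⊆ Ioo 0 L := ordConnected_Ioo.uIcc_subset ha hb
  have hint : IntervalIntegrable G' volume a b := (hG'.mono hsub).intervalIntegrable
  exact ⟨hint, (intervalIntegral.integral_eq_sub_of_hasDerivAt
    (fun x hx => hG x (hsub hx)) hint).symm⟩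

end IntegrationByParts

/-! ### Calculus and integrability of sin^S θ · exp(-βθ/S) · Q(cot θ). -/

section Model

open Set Filter Topology Polynomial

/-- The sign conditions on the parameters. -/
structure Params.IsPhysical (p : Params) : Prop where
  hbar_pos : 0 < p.hbar
  mass_pos : 0 < p.mass
  L_pos : 0 < p.L
  nu_nonneg : 0 ≤ p.nu
  beta_nonneg : 0 ≤ p.beta

/-- The shifted quantum number `j + ν + 1`. -/
noncomputable def Params.idx (p : Params) (j : ℕ) : ℝ := j + p.nu + 1

/-- The momentum scale `ħ π / L`. -/
noncomputable def Params.scale (p : Params) : ℝ := p.hbar * Real.pi / p.L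

/-- The function `cot (π x / L)`. -/
noncomputable def Params.cot (p : Params) (x : ℝ) : ℝ := Real.cot (Real.pi * x / p.L)

/-- The function `sin^S (π x / L) exp (-β π x / (L S))`. -/
noncomputable def Params.envelope (p : Params) (S x : ℝ) : ℝ :=
  Real.sin (Real.pi * x / p.L) ^ S * Real.exp (-(p.beta * Real.pi * x / (p.L * S)))

/-- The function `sin^S (π x / L) exp (-β π x / (L S)) Q (cot (π x / L))`. -/
noncomputable def Params.profile (p : Params) (S : ℝ) (Q : ℂ[X]) (x : ℝ) : ℂ :=
  (p.envelope S x : ℂ) * Q.eval (p.cot x : ℂ)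

/-- The superpotential in closed form, `-(ħ π / L) (s cot (π x / L) - β / s)`. -/
noncomputable def Params.cotPotential (p : Params) (s x : ℝ) : ℝ :=
  -p.scale * (s * p.cot x - p.beta / s)

/-- The derivative of `profile S Q` is `(π / L) profile S (derivPoly S Q)`. -/
noncomputable def Params.derivPoly (p : Params) (S : ℝ) (Q : ℂ[X]) : ℂ[X] :=
  (C (S : ℂ) * X - C (p.beta / S : ℂ)) * Q - (1 + X ^ 2) * derivative Q

variable {p : Params}

theorem Params.IsPhysical.one_le_idx (hp : p.IsPhysical) (j : ℕ) : 1 ≤ p.idx j := by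
  have := hp.nu_nonneg
  have : (0 : ℝ) ≤ j := Nat.cast_nonneg j
  unfold Params.idx
  linarith

theorem Params.IsPhysical.idx_pos (hp : p.IsPhysical) (j : ℕ) : 0 < p.idx j :=
  one_pos.trans_le (hp.one_le_idx j)

theorem Params.IsPhysical.scale_pos (hp : p.IsPhysical) : 0 < p.scale :=
  div_pos (mul_pos hp.hbar_pos Real.pi_pos) hp.L_pos

theorem Params.idx_succ (p : Params) (j : ℕ) : p.idx (j + 1) = p.idx j + 1 := by
  unfold Params.idx; push_cast; ring

theorem Params.idx_add (p : Params) (m d : ℕ) : p.idx (m + d) = p.idx m + d := by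
  unfold Params.idx; push_cast; ring

theorem Params.IsPhysical.sin_pos (hp : p.IsPhysical) {x : ℝ} (hx : x ∈ Ioo 0 p.L) :
    0 < Real.sin (Real.pi * x / p.L) := by
  have hL := hp.L_pos
  refine Real.sin_pos_of_pos_of_lt_pi (div_pos (mul_pos Real.pi_pos hx.1) hL) ?_
  rw [div_lt_iff₀ hL]
  exact mul_lt_mul_of_pos_left hx.2 Real.pi_pos

theorem hasDerivAt_angle (p : Params) (x : ℝ) :
    HasDerivAt (fun x => Real.pi * x / p.L) (Real.pi / p.L) x := by
  simpa using ((hasDerivAt_id x).const_mul Real.pi).div_const p.L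

theorem Params.IsPhysical.hasDerivAt_cot (hp : p.IsPhysical) {x : ℝ} (hx : x ∈ Ioo 0 p.L) :
    HasDerivAt p.cot (-(Real.pi / p.L) * (1 + p.cot x ^ 2)) x := by
  have h0 := (hp.sin_pos hx).ne'
  have ha := hasDerivAt_angle p x
  have h1 := ha.cos.div ha.sin h0
  have heq : p.cot = (fun x => Real.cos (Real.pi * x / p.L)) /
      fun x => Real.sin (Real.pi * x / p.L) := by
    funext y
    exact Real.cot_eq_cos_div_sin _
  rw [heq]
  refine h1.congr_deriv ?_
  simp only [Pi.div_apply]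
  field_simp
  ring

theorem Params.IsPhysical.hasDerivAt_envelope (hp : p.IsPhysical) {S x : ℝ} (hS : S ≠ 0)
    (hx : x ∈ Ioo 0 p.L) :
    HasDerivAt (p.envelope S)
      (Real.pi / p.L * (S * p.cot x - p.beta / S) * p.envelope S x) x := by
  have h0 := hp.sin_pos hx
  have hL := hp.L_pos.ne'
  have ha := hasDerivAt_angle p x
  have h1 := ha.sin.rpow_const (p := S) (Or.inl h0.ne')
  have h2 : HasDerivAt (fun x => -(p.beta * Real.pi * x / (p.L * S)))
      (-(p.beta * Real.pi / (p.L * S))) x := by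
    simpa using (((hasDerivAt_id x).const_mul (p.beta * Real.pi)).div_const (p.L * S)).fun_neg
  refine (h1.mul h2.exp).congr_deriv ?_
  rw [Params.envelope, Params.cot, Real.cot_eq_cos_div_sin, Real.rpow_sub_one h0.ne']
  field_simp
  ring

theorem Params.IsPhysical.envelope_pos (hp : p.IsPhysical) (S : ℝ) {x : ℝ} (hx : x ∈ Ioo 0 p.L) :
    0 < p.envelope S x :=
  mul_pos (Real.rpow_pos_of_pos (hp.sin_pos hx) _) (Real.exp_pos _)

theorem Params.IsPhysical.hasDerivAt_profile (hp : p.IsPhysical) {S x : ℝ} (hS : S ≠ 0)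
    (Q : ℂ[X]) (hx : x ∈ Ioo 0 p.L) :
    HasDerivAt (p.profile S Q) ((Real.pi / p.L : ℝ) * p.profile S (p.derivPoly S Q) x) x := by
  have h1 := (hp.hasDerivAt_envelope hS hx).ofReal_comp
  have h2 := (Q.hasDerivAt (p.cot x : ℂ)).comp x (hp.hasDerivAt_cot hx).ofReal_comp
  refine (h1.mul h2).congr_deriv ?_
  simp only [Params.profile, Params.derivPoly, eval_mul, eval_sub, eval_C, eval_X, eval_add,
    eval_one, eval_pow, Function.comp_apply]
  push_cast
  ring

theorem Params.IsPhysical.continuousOn_profile (hp : p.IsPhysical) {S : ℝ} (hS : S ≠ 0)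
    (Q : ℂ[X]) : ContinuousOn (p.profile S Q) (Ioo 0 p.L) :=
  fun _ hx => (hp.hasDerivAt_profile hS Q hx).continuousAt.continuousWithinAt

theorem profile_lowerPoly (p : Params) (S s x : ℝ) (Q : ℂ[X]) :
    (p.hbar : ℂ) * ((Real.pi / p.L : ℝ) * p.profile S (p.derivPoly S Q) x) +
      (p.cotPotential s x : ℂ) * p.profile S Q x =
        (p.scale : ℂ) * p.profile S (lowerPoly p.beta S s Q) x := by
  simp only [Params.profile, Params.derivPoly, lowerPoly, Params.cotPotential, Params.scale,
    eval_mul, eval_sub, eval_C, eval_X, eval_add, eval_one, eval_pow]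
  push_cast
  ring

theorem profile_raisePoly (p : Params) (S s x : ℝ) (Q : ℂ[X]) :
    -(p.hbar : ℂ) * ((Real.pi / p.L : ℝ) * p.profile S (p.derivPoly S Q) x) +
      (p.cotPotential s x : ℂ) * p.profile S Q x =
        (p.scale : ℂ) * p.profile S (raisePoly p.beta S s Q) x := by
  simp only [Params.profile, Params.derivPoly, raisePoly, Params.cotPotential, Params.scale,
    eval_mul, eval_sub, eval_C, eval_X, eval_add, eval_one, eval_pow]
  push_cast
  ring

theorem profile_C_mul (p : Params) (S x : ℝ) (c : ℂ) (Q : ℂ[X]) :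
    p.profile S (C c * Q) x = c * p.profile S Q x := by
  simp only [Params.profile, eval_mul, eval_C]
  ring

theorem profile_zero (p : Params) (S x : ℝ) : p.profile S 0 x = 0 := by
  simp [Params.profile]

/-- sin^S cot^k = sin^{S-k} cos^k with S - k ≥ 1, and the exponential is at most 1 since β ≥ 0. The
bound by the sine gives both square integrability and the linear decay at the two end points. -/
theorem Params.IsPhysical.exists_norm_profile_le (hp : p.IsPhysical) {S : ℝ} {d : ℕ}
    (hS : d + 1 ≤ S) {Q : ℂ[X]} (hQ : ∀ k, d < k → Q.coeff k = 0) :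
    ∃ K, 0 ≤ K ∧ ∀ x ∈ Ioo 0 p.L, ‖p.profile S Q x‖ ≤ K * Real.sin (Real.pi * x / p.L) := by
  refine ⟨∑ k ∈ Finset.range (d + 1), ‖Q.coeff k‖, by positivity, fun x hx => ?_⟩
  have hs := hp.sin_pos hx
  have hS0 : 0 < S := by
    have : (0 : ℝ) ≤ d := Nat.cast_nonneg d
    linarith
  have hexp : Real.exp (-(p.beta * Real.pi * x / (p.L * S))) ≤ 1 := by
    rw [Real.exp_le_one_iff, neg_nonpos]
    have := hp.beta_nonneg
    have := hp.L_pos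
    have := hx.1
    have := Real.pi_pos
    positivity
  have hdeg : Q.natDegree < d + 1 := Nat.lt_succ_of_le (natDegree_le_iff_coeff_eq_zero.2 hQ)
  have hterm : ∀ k ∈ Finset.range (d + 1), p.envelope S x * (‖Q.coeff k‖ * |p.cot x| ^ k) ≤
      ‖Q.coeff k‖ * Real.sin (Real.pi * x / p.L) := by
    intro k hk
    have hk' : (k : ℝ) ≤ d := by exact_mod_cast Nat.lt_succ_iff.1 (Finset.mem_range.1 hk)
    set t := Real.sin (Real.pi * x / p.L)
    set c := Real.cos (Real.pi * x / p.L)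
    have h1 : t ^ S * |p.cot x| ^ k = t ^ (S - k) * |c| ^ k := by
      rw [Params.cot, Real.cot_eq_cos_div_sin, abs_div, abs_of_pos hs, div_pow,
        Real.rpow_sub_natCast hs.ne']
      ring
    have h2 : t ^ (S - k) ≤ t := by
      calc t ^ (S - k) ≤ t ^ (1 : ℝ) :=
            Real.rpow_le_rpow_of_exponent_ge hs (Real.sin_le_one _) (by linarith)
        _ = t := Real.rpow_one t
    have h3 : |c| ^ k ≤ 1 := pow_le_one₀ (abs_nonneg _) (Real.abs_cos_le_one _)
    have h4 : t ^ (S - k) * |c| ^ k ≤ t * 1 :=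
      mul_le_mul h2 h3 (by positivity) hs.le
    calc p.envelope S x * (‖Q.coeff k‖ * |p.cot x| ^ k)
        = ‖Q.coeff k‖ * ((t ^ S * |p.cot x| ^ k) *
            Real.exp (-(p.beta * Real.pi * x / (p.L * S)))) := by
          rw [Params.envelope]; ring
      _ ≤ ‖Q.coeff k‖ * (t * 1) := by
          refine mul_le_mul_of_nonneg_left ?_ (norm_nonneg _)
          rw [h1]
          exact mul_le_mul (h4.trans_eq (mul_one t)) hexp (Real.exp_pos _).le hs.le
      _ = _ := by rw [mul_one]
  rw [Params.profile, norm_mul, Complex.norm_real, Real.norm_of_nonneg (hp.envelope_pos S hx).le,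
    eval_eq_sum_range' hdeg, Finset.sum_mul]
  calc _ ≤ p.envelope S x * ∑ k ∈ Finset.range (d + 1), ‖Q.coeff k‖ * |p.cot x| ^ k := by
        refine mul_le_mul_of_nonneg_left ?_ (hp.envelope_pos S hx).le
        refine (norm_sum_le _ _).trans (Finset.sum_le_sum fun k _ => ?_)
        rw [norm_mul, norm_pow, Complex.norm_real, Real.norm_eq_abs]
    _ ≤ _ := by
        rw [Finset.mul_sum]
        exact Finset.sum_le_sum hterm

theorem Params.IsPhysical.sin_le (hp : p.IsPhysical) {x : ℝ} (hx : x ∈ Ioo 0 p.L) :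
    Real.sin (Real.pi * x / p.L) ≤ Real.pi / p.L * x ∧
      Real.sin (Real.pi * x / p.L) ≤ Real.pi / p.L * (p.L - x) := by
  have hL := hp.L_pos
  constructor
  · calc _ ≤ Real.pi * x / p.L :=
          Real.sin_le (div_pos (mul_pos Real.pi_pos hx.1) hL).le
      _ = _ := by ring
  · have h : Real.pi - Real.pi * x / p.L = Real.pi / p.L * (p.L - x) := by
      field_simp
    rw [← Real.sin_pi_sub, h]
    exact Real.sin_le (mul_pos (div_pos Real.pi_pos hL) (sub_pos.2 hx.2)).le

theorem memLp_of_continuousOn_of_bound {L K : ℝ} {f : ℝ → ℂ} (hf : ContinuousOn f (Ioo 0 L))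
    (hb : ∀ x ∈ Ioo 0 L, ‖f x‖ ≤ K) : MemLp f 2 (mu L) :=
  MemLp.of_bound (hf.aestronglyMeasurable measurableSet_Ioo) K
    ((ae_restrict_iff' measurableSet_Ioo).2 (Eventually.of_forall hb))

theorem Params.IsPhysical.memLp_profile (hp : p.IsPhysical) {S : ℝ} {d : ℕ}
    (hS : d + 1 ≤ S) {Q : ℂ[X]} (hQ : ∀ k, d < k → Q.coeff k = 0) :
    MemLp (p.profile S Q) 2 (mu p.L) := by
  obtain ⟨K, hK, hb⟩ := hp.exists_norm_profile_le hS hQ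
  have hS0 : S ≠ 0 := by
    have : (0 : ℝ) ≤ d := Nat.cast_nonneg d
    linarith
  refine memLp_of_continuousOn_of_bound (K := K) (hp.continuousOn_profile hS0 Q) fun x hx => ?_
  exact (hb x hx).trans (mul_le_of_le_one_right hK (Real.sin_le_one _))

theorem exists_cot_eq (hp : p.IsPhysical) (y : ℝ) : ∃ x ∈ Ioo 0 p.L, p.cot x = y := by
  have hL := hp.L_pos
  have hpi := Real.pi_pos
  have h1 := Real.neg_pi_div_two_lt_arctan y
  have h2 := Real.arctan_lt_pi_div_two y
  refine ⟨p.L / Real.pi * (Real.pi / 2 - Real.arctan y), ⟨?_, ?_⟩, ?_⟩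
  · exact mul_pos (div_pos hL hpi) (by linarith)
  · calc _ < p.L / Real.pi * Real.pi :=
          mul_lt_mul_of_pos_left (by linarith) (div_pos hL hpi)
      _ = p.L := div_mul_cancel₀ _ hpi.ne'
  · have h3 : Real.pi * (p.L / Real.pi * (Real.pi / 2 - Real.arctan y)) / p.L =
        Real.pi / 2 - Real.arctan y := by field_simp
    rw [Params.cot, h3, Real.cot_eq_cos_div_sin, Real.cos_pi_div_two_sub, Real.sin_pi_div_two_sub,
      ← Real.tan_eq_sin_div_cos, Real.tan_arctan]

/-- If the integral were zero, continuity would make the function vanish on all of (0, L); since cot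
takes every real value there, Q would have infinitely many roots. -/
theorem Params.IsPhysical.integral_norm_profile_pos (hp : p.IsPhysical) {S : ℝ} {d : ℕ}
    (hS : d + 1 ≤ S) {Q : ℂ[X]} (hQ : ∀ k, d < k → Q.coeff k = 0) (hQ0 : Q ≠ 0) :
    0 < ∫ x, ‖p.profile S Q x‖ ^ 2 ∂(mu p.L) := by
  have hS0 : S ≠ 0 := by
    have : (0 : ℝ) ≤ d := Nat.cast_nonneg d
    linarith
  have hint := (hp.memLp_profile hS hQ).norm.integrable_sq
  refine lt_of_le_of_ne (integral_nonneg fun x => by positivity) fun h0 => hQ0 ?_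
  have h1 := (integral_eq_zero_iff_of_nonneg (fun x => by positivity) hint).1 h0.symm
  have h2 : p.profile S Q =ᵐ[volume.restrict (Ioo 0 p.L)] fun _ => 0 := by
    filter_upwards [h1] with x hx
    simpa using hx
  have h3 := Measure.eqOn_open_of_ae_eq h2 isOpen_Ioo (hp.continuousOn_profile hS0 Q)
    continuousOn_const
  refine Polynomial.eq_zero_of_infinite_isRoot Q
    ((Set.infinite_range_of_injective Complex.ofReal_injective).mono ?_)
  rintro _ ⟨y, rfl⟩
  obtain ⟨x, hx, rfl⟩ := exists_cot_eq hp y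
  have h4 := h3 hx
  exact (mul_eq_zero.1 h4).resolve_left (Complex.ofReal_ne_zero.2 (hp.envelope_pos S hx).ne')

/-! ### The hierarchy in closed form -/

/-- The polynomials in `cot (π x / L)` that describe the functions `A_{m-1} ⋯ A_0 φ_j`. -/
noncomputable def Params.ladderPoly (p : Params) (j : ℕ) : ℕ → ℂ[X]
  | 0 => cotPoly j (p.a j) (starRingEnd ℂ (p.a j))
  | m + 1 => lowerPoly p.beta (p.idx j) (p.idx m) (p.ladderPoly j m)

theorem rawEigenfun_eq (p : Params) (n : ℕ) :
    p.rawEigenfun n = p.profile (p.idx n) (p.ladderPoly n 0) := by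
  funext x
  have h : p.nu + n + 1 = p.idx n := by unfold Params.idx; ring
  rw [Params.rawEigenfun, Params.profile, Params.ladderPoly, eval_cotPoly, h]
  rfl

theorem Params.IsPhysical.raisePoly_lowerPoly (hp : p.IsPhysical) (j m : ℕ) :
    raisePoly p.beta (p.idx j) (p.idx m) (p.ladderPoly j (m + 1)) =
      C (energyGap p.beta (p.idx j) (p.idx m)) * p.ladderPoly j m := by
  induction m with
  | zero =>
    have h0 := (hp.idx_pos 0).ne'
    have hj := (hp.idx_pos j).ne'
    have e : p.idx j = p.idx 0 + j := by simpa using p.idx_add 0 j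
    have ec : ((p.idx j : ℝ) : ℂ) = (p.idx 0 : ℂ) + j := by rw [e]; push_cast; rfl
    rw [Params.ladderPoly, Params.ladderPoly, ec]
    have ha : p.a j = -((p.idx 0 : ℂ) + j) + Complex.I * (p.beta / ((p.idx 0 : ℂ) + j)) := by
      rw [← ec, Params.a]
      change -((p.idx j : ℝ) : ℂ) + Complex.I * ((p.beta / p.idx j : ℝ) : ℂ) = _
      push_cast
      rfl
    refine raisePoly_lowerPoly_cotPoly j p.beta (p.idx 0) _ _ (Complex.ofReal_ne_zero.2 h0) ?_ ha ?_
    · rw [← ec]; exact Complex.ofReal_ne_zero.2 hj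
    · rw [ha, ← ec]
      simp only [map_add, map_neg, map_mul, Complex.conj_I, map_div₀, Complex.conj_ofReal]
      ring
  | succ m ih =>
    have h := raisePoly_lowerPoly_lowerPoly p.beta (p.idx j) (p.idx m)
      (Complex.ofReal_ne_zero.2 (hp.idx_pos m).ne') (by
        have := (hp.idx_pos (m + 1)).ne'
        rw [p.idx_succ] at this
        exact_mod_cast this) _ ih
    rw [Params.ladderPoly, Params.ladderPoly, p.idx_succ]
    push_cast
    exact h

/-- The degree is at most j - m, written without truncated subtraction so that m > j gives the zero
polynomial. The choice of S only keeps lowering from increasing the degree; the eigenvalue equation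
removes the remaining leading term. -/
theorem Params.IsPhysical.coeff_ladderPoly (hp : p.IsPhysical) (j m k : ℕ) (h : j < m + k) :
    (p.ladderPoly j m).coeff k = 0 := by
  induction m generalizing k with
  | zero => exact coeff_cotPoly_eq_zero _ _ _ _ (by omega)
  | succ m ih =>
    rcases le_or_gt m j with hmj | hmj
    · refine coeff_lowerPoly_eq_zero _ _ _ (Complex.ofReal_ne_zero.2 (hp.idx_pos m).ne') (j - m) ?_
        _ (hp.raisePoly_lowerPoly j m) (fun k hk => ih k (by omega)) k (by omega)
      have := p.idx_add m (j - m)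
      rw [Nat.add_sub_cancel' hmj] at this
      rw [this]; push_cast [hmj]; rfl
    · have h0 : p.ladderPoly j m = 0 := by
        ext i
        rw [ih i (by omega), coeff_zero]
      rw [Params.ladderPoly, h0, lowerPoly_zero, coeff_zero]

theorem Params.IsPhysical.ladderPoly_eq_zero (hp : p.IsPhysical) {j m : ℕ} (h : j < m) :
    p.ladderPoly j m = 0 := by
  ext i
  rw [hp.coeff_ladderPoly j m i (by omega), coeff_zero]

/-- The dimensionless energy difference `2 M (E_j - E_m) / (ħ π / L)²`. -/
noncomputable def Params.gap (p : Params) (m j : ℕ) : ℝ :=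
  (p.idx j - p.idx m) * (p.idx j + p.idx m) * (1 + p.beta ^ 2 / (p.idx m * p.idx j) ^ 2)

theorem Params.IsPhysical.energyGap_eq (hp : p.IsPhysical) (m j : ℕ) :
    energyGap p.beta (p.idx j) (p.idx m) = (p.gap m j : ℂ) := by
  have h1 := (hp.idx_pos m).ne'
  have h2 := (hp.idx_pos j).ne'
  have h : ((p.idx j) ^ 2 - (p.beta / p.idx j) ^ 2) - (p.idx m ^ 2 - (p.beta / p.idx m) ^ 2) =
      p.gap m j := by
    unfold Params.gap
    field_simp
    ring
  rw [← h, energyGap]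
  push_cast
  ring

theorem Params.IsPhysical.energy_sub (hp : p.IsPhysical) (m j : ℕ) :
    2 * p.mass * (p.energy j - p.energy m) = p.scale ^ 2 * p.gap m j := by
  have h1 := (hp.idx_pos m).ne'
  have h2 := (hp.idx_pos j).ne'
  have h3 := hp.mass_pos.ne'
  have h4 := hp.L_pos.ne'
  have e : ∀ i : ℕ, p.energy i = p.eps * (p.idx i ^ 2 - p.beta ^ 2 / p.idx i ^ 2) := fun _ => rfl
  rw [e, e]
  unfold Params.gap Params.scale Params.eps
  field_simp
  ring

theorem Params.IsPhysical.gap_pos (hp : p.IsPhysical) {m j : ℕ} (h : m < j) : 0 < p.gap m j := by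
  have h1 := hp.idx_pos m
  have h2 := hp.idx_pos j
  have h3 : p.idx m < p.idx j := by
    have : (m : ℝ) < j := by exact_mod_cast h
    unfold Params.idx
    linarith
  unfold Params.gap
  have := sub_pos.2 h3
  positivity

theorem Params.gap_self (p : Params) (m : ℕ) : p.gap m m = 0 := by
  simp [Params.gap]

/-- The factor `√(2M (E_j - E_m))`. -/
noncomputable def Params.step (p : Params) (m j : ℕ) : ℝ :=
  Real.sqrt (2 * p.mass * (p.energy j - p.energy m))

theorem Params.IsPhysical.sq_step (hp : p.IsPhysical) {m j : ℕ} (h : m ≤ j) :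
    p.step m j ^ 2 = p.scale ^ 2 * p.gap m j := by
  rw [Params.step, hp.energy_sub, Real.sq_sqrt]
  rcases h.eq_or_lt with rfl | h
  · rw [p.gap_self, mul_zero]
  · exact (mul_pos (pow_pos hp.scale_pos 2) (hp.gap_pos h)).le

theorem Params.IsPhysical.step_pos (hp : p.IsPhysical) {m j : ℕ} (h : m < j) : 0 < p.step m j := by
  rw [Params.step, hp.energy_sub, Real.sqrt_pos]
  exact mul_pos (pow_pos hp.scale_pos 2) (hp.gap_pos h)

theorem Params.step_self (p : Params) (m : ℕ) : p.step m m = 0 := by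
  simp [Params.step]

/-- Since E_k < E_j for k < m ≤ j, the square root may be taken factor by factor; consecutive
normalizations then differ by one `step`. -/
theorem Params.IsPhysical.hierNorm_eq (hp : p.IsPhysical) {m j : ℕ} (h : m ≤ j) :
    p.hierNorm m j = ∏ k ∈ Finset.range m, p.step k j := by
  have h1 : (2 * p.mass) ^ m * ∏ k ∈ Finset.range m, (p.energy j - p.energy k) =
      (∏ k ∈ Finset.range m, p.step k j) ^ 2 := by
    rw [← Finset.prod_pow]
    have : (2 * p.mass) ^ m = ∏ _k ∈ Finset.range m, (2 * p.mass) := by simp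
    rw [this, ← Finset.prod_mul_distrib]
    refine Finset.prod_congr rfl fun k hk => ?_
    rw [hp.sq_step ((Finset.mem_range.1 hk).le.trans h), hp.energy_sub]
  rw [Params.hierNorm, h1, Real.sqrt_sq]
  exact Finset.prod_nonneg fun k _ => Real.sqrt_nonneg _

theorem Params.IsPhysical.hierNorm_pos (hp : p.IsPhysical) {m j : ℕ} (h : m ≤ j) :
    0 < p.hierNorm m j := by
  rw [hp.hierNorm_eq h]
  exact Finset.prod_pos fun k hk => hp.step_pos ((Finset.mem_range.1 hk).trans_le h)

/-- At m = 0 the Pochhammer argument is -j - 2ν - 1, which lies below every -k with k < j. Later, if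
lowering gave 0, raising back would give 0 = gap · Q with a positive gap. -/
theorem Params.IsPhysical.ladderPoly_ne_zero (hp : p.IsPhysical) {j m : ℕ} (h : m ≤ j) :
    p.ladderPoly j m ≠ 0 := by
  induction m with
  | zero =>
    refine cotPoly_ne_zero _ _ _ fun k _ h0 => ?_
    have h1 := congrArg Complex.re h0
    simp only [Params.a, Complex.add_re, Complex.neg_re, Complex.ofReal_re, Complex.mul_re,
      Complex.I_re, Complex.I_im, Complex.ofReal_im, Complex.conj_re, Complex.natCast_re,
      Complex.one_re] at h1
    have := hp.nu_nonneg
    have hk : (k : ℝ) < j := by exact_mod_cast ‹k < j›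
    linarith
  | succ m ih =>
    intro h0
    have h1 := hp.raisePoly_lowerPoly j m
    rw [h0, raisePoly_zero, hp.energyGap_eq] at h1
    rcases mul_eq_zero.1 h1.symm with h2 | h2
    · rw [C_eq_zero, Complex.ofReal_eq_zero] at h2
      exact (hp.gap_pos h).ne' h2
    · exact ih (by omega) h2

theorem Params.IsPhysical.le_idx (hp : p.IsPhysical) {j m : ℕ} (h : m ≤ j) :
    ((j - m : ℕ) : ℝ) + 1 ≤ p.idx j := by
  have := p.idx_add m (j - m)
  rw [Nat.add_sub_cancel' h] at this
  rw [this]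
  linarith [hp.one_le_idx m]

theorem integral_norm_rawEigenfun (hp : p.IsPhysical) (n : ℕ) :
    ∫ x in (0 : ℝ)..p.L, ‖p.rawEigenfun n x‖ ^ 2 =
      ∫ x, ‖p.profile (p.idx n) (p.ladderPoly n 0) x‖ ^ 2 ∂(mu p.L) := by
  rw [rawEigenfun_eq, intervalIntegral.integral_of_le hp.L_pos.le, integral_Ioc_eq_integral_Ioo, mu]

theorem Params.IsPhysical.integral_pos (hp : p.IsPhysical) (n : ℕ) :
    0 < ∫ x in (0 : ℝ)..p.L, ‖p.rawEigenfun n x‖ ^ 2 := by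
  rw [integral_norm_rawEigenfun hp]
  exact hp.integral_norm_profile_pos (d := n) (by simpa using hp.le_idx (Nat.zero_le n))
    (fun k hk => hp.coeff_ladderPoly n 0 k (by omega)) (hp.ladderPoly_ne_zero (Nat.zero_le n))

theorem Params.IsPhysical.normConst_pos (hp : p.IsPhysical) (n : ℕ) : 0 < p.normConst n :=
  inv_pos.2 (Real.sqrt_pos.2 (hp.integral_pos n))

/-- The ground state is a multiple of the envelope because `ladderPoly m m` is constant, and W is
its logarithmic derivative. The closed form is a hypothesis because the induction in `ladder_eq`
uses this lemma. -/
theorem superpot_eq_of_ladder_eq (hp : p.IsPhysical) {m : ℕ}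
    (h : ∀ x ∈ Ioo 0 p.L, p.ladder m m x =
      (p.normConst m * p.scale ^ m : ℝ) * p.profile (p.idx m) (p.ladderPoly m m) x)
    {x : ℝ} (hx : x ∈ Ioo 0 p.L) : p.superpot m x = p.cotPotential (p.idx m) x := by
  obtain ⟨c, hc⟩ : ∃ c, p.ladderPoly m m = C c :=
    ⟨_, eq_C_of_natDegree_le_zero (natDegree_le_iff_coeff_eq_zero.2
      fun k hk => hp.coeff_ladderPoly m m k (by omega))⟩
  have hc0 : c ≠ 0 := fun h0 => hp.ladderPoly_ne_zero (le_refl m) (by rw [hc, h0, C_0])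
  set κ : ℂ := (p.normConst m * p.scale ^ m : ℝ) * c / (p.hierNorm m m : ℂ) with hκ
  have hκ0 : κ ≠ 0 := by
    refine div_ne_zero (mul_ne_zero ?_ hc0) (Complex.ofReal_ne_zero.2 (hp.hierNorm_pos le_rfl).ne')
    exact Complex.ofReal_ne_zero.2
      (mul_pos (hp.normConst_pos m) (pow_pos hp.scale_pos m)).ne'
  have hf : ∀ y ∈ Ioo 0 p.L, p.hierEigenfun m 0 y = κ * (p.envelope (p.idx m) y : ℂ) := by
    intro y hy
    rw [Params.hierEigenfun, zero_add, h y hy, hc, Params.profile, eval_C, hκ]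
    ring
  have hd : HasDerivAt (p.hierEigenfun m 0) _ x :=
    ((hp.hasDerivAt_envelope (hp.idx_pos m).ne' hx).ofReal_comp.const_mul κ).congr_of_eventuallyEq
      (by filter_upwards [isOpen_Ioo.mem_nhds hx] with y hy using hf y hy)
  have he : (p.envelope (p.idx m) x : ℂ) ≠ 0 :=
    Complex.ofReal_ne_zero.2 (hp.envelope_pos _ hx).ne'
  rw [Params.superpot, superpotOf, hd.deriv, hf x hx, Params.cotPotential, Params.scale,
    div_eq_iff (mul_ne_zero hκ0 he)]
  push_cast
  ring

/-- All levels j are treated together, since W_m is built from the level j = m. -/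
theorem Params.IsPhysical.ladder_eq (hp : p.IsPhysical) (m j : ℕ) {x : ℝ} (hx : x ∈ Ioo 0 p.L) :
    p.ladder m j x =
      (p.normConst j * p.scale ^ m : ℝ) * p.profile (p.idx j) (p.ladderPoly j m) x := by
  induction m generalizing j x with
  | zero =>
    rw [Params.ladder, Params.eigenfun, rawEigenfun_eq, pow_zero, mul_one]
  | succ m ih =>
    have hd : HasDerivAt (p.ladder m j) _ x :=
      ((hp.hasDerivAt_profile (hp.idx_pos j).ne' (p.ladderPoly j m) hx).const_mul
        ((p.normConst j * p.scale ^ m : ℝ) : ℂ)).congr_of_eventuallyEq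
        (by filter_upwards [isOpen_Ioo.mem_nhds hx] with y hy using ih j hy)
    rw [p.ladder_succ, applyA, hd.deriv, superpot_eq_of_ladder_eq hp (fun y hy => ih m hy) hx,
      ih j hx, Params.ladderPoly, pow_succ]
    have h := profile_lowerPoly p (p.idx j) (p.idx m) x (p.ladderPoly j m)
    push_cast at h ⊢
    linear_combination ((p.normConst j : ℂ) * (p.scale : ℂ) ^ m) * h

theorem Params.IsPhysical.superpot_eq (hp : p.IsPhysical) (m : ℕ) {x : ℝ} (hx : x ∈ Ioo 0 p.L) :
    p.superpot m x = p.cotPotential (p.idx m) x :=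
  superpot_eq_of_ladder_eq hp (fun _ hy => hp.ladder_eq m m hy) hx

end Model

/-! ### Test functions -/

section TestFunctions

open Set Filter Topology
open scoped ContDiff

/-- Smooth functions with compact support in `(0, L)`. -/
structure IsTestFun (L : ℝ) (φ : ℝ → ℂ) : Prop where
  contDiff : ContDiff ℝ ∞ φ
  hasCompactSupport : HasCompactSupport φ
  tsupport_subset : tsupport φ ⊆ Ioo 0 L

variable {L : ℝ} {φ ψ : ℝ → ℂ}

theorem IsTestFun.add (hφ : IsTestFun L φ) (hψ : IsTestFun L ψ) : IsTestFun L (φ + ψ) :=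
  ⟨hφ.contDiff.add hψ.contDiff, hφ.hasCompactSupport.add hψ.hasCompactSupport,
    (tsupport_add φ ψ).trans (union_subset hφ.tsupport_subset hψ.tsupport_subset)⟩

theorem IsTestFun.mul_left (hφ : IsTestFun L φ) {W : ℝ → ℂ} (hW : ContDiffOn ℝ ∞ W (Ioo 0 L)) :
    IsTestFun L (W * φ) := by
  have hsub : tsupport (W * φ) ⊆ tsupport φ := tsupport_mul_subset_right
  refine ⟨contDiff_iff_contDiffAt.2 fun x => ?_, hφ.hasCompactSupport.mul_left,
    hsub.trans hφ.tsupport_subset⟩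
  by_cases hx : x ∈ tsupport φ
  · exact (hW.contDiffAt (isOpen_Ioo.mem_nhds (hφ.tsupport_subset hx))).mul hφ.contDiff.contDiffAt
  · have h0 : W * φ =ᶠ[𝓝 x] fun _ => 0 :=
      notMem_tsupport_iff_eventuallyEq.1 fun h => hx (hsub h)
    exact contDiffAt_const.congr_of_eventuallyEq h0

theorem IsTestFun.deriv (hφ : IsTestFun L φ) : IsTestFun L (deriv φ) :=
  ⟨(contDiff_infty_iff_deriv.1 hφ.contDiff).2, hφ.hasCompactSupport.deriv,
    tsupport_deriv_subset.trans hφ.tsupport_subset⟩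

theorem IsTestFun.memLp (hφ : IsTestFun L φ) : MemLp φ 2 (mu L) :=
  hφ.contDiff.continuous.memLp_of_hasCompactSupport hφ.hasCompactSupport

/-- Dividing φ by x or by L - x gives a test function again, hence a bounded one. -/
theorem IsTestFun.exists_bound (hφ : IsTestFun L φ) :
    ∃ K, (∀ x ∈ Ioo 0 L, ‖φ x‖ ≤ K * x) ∧ ∀ x ∈ Ioo 0 L, ‖φ x‖ ≤ K * (L - x) := by
  have key : ∀ g : ℝ → ℝ, ContDiff ℝ ∞ g → (∀ x ∈ Ioo 0 L, 0 < g x) →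
      ∃ K, ∀ x ∈ Ioo 0 L, ‖φ x‖ ≤ K * g x := by
    intro g hg hpos
    have hW : ContDiffOn ℝ ∞ (fun x => (((g x)⁻¹ : ℝ) : ℂ)) (Ioo 0 L) :=
      Complex.ofRealCLM.contDiff.comp_contDiffOn (hg.contDiffOn.inv fun x hx => (hpos x hx).ne')
    have ht := hφ.mul_left hW
    obtain ⟨K, hK⟩ := ht.contDiff.continuous.bounded_above_of_compact_support ht.hasCompactSupport
    refine ⟨K, fun x hx => ?_⟩
    have h := hK x
    rw [Pi.mul_apply, norm_mul, Complex.norm_real,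
      Real.norm_of_nonneg (inv_nonneg.2 (hpos x hx).le),
      inv_mul_le_iff₀ (hpos x hx), mul_comm] at h
    exact h
  obtain ⟨K₁, h₁⟩ := key (fun x => x) contDiff_id fun x hx => hx.1
  obtain ⟨K₂, h₂⟩ := key (fun x => L - x) (contDiff_const.sub contDiff_id)
    fun x hx => sub_pos.2 hx.2
  refine ⟨max K₁ K₂, fun x hx => ?_, fun x hx => ?_⟩
  · exact (h₁ x hx).trans (mul_le_mul_of_nonneg_right (le_max_left _ _) hx.1.le)
  · exact (h₂ x hx).trans (mul_le_mul_of_nonneg_right (le_max_right _ _) (sub_pos.2 hx.2).le)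

/-- The classes of the test functions. -/
def testVectors (L : ℝ) : Set (Hilb L) := {u | ∃ φ, IsTestFun L φ ∧ u =ᵐ[mu L] φ}

/-- A vector orthogonal to all test functions vanishes, by the fundamental lemma of the calculus of
variations; real test functions suffice. -/
theorem dense_of_testVectors_subset {P : Submodule ℂ (Hilb L)} (h : testVectors L ⊆ P) :
    Dense (P : Set (Hilb L)) := by
  rw [Submodule.dense_iff_topologicalClosure_eq_top, Submodule.topologicalClosure_eq_top_iff,
    Submodule.eq_bot_iff]
  intro v hv
  have hloc : LocallyIntegrableOn v (Ioo 0 L) volume := by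
    have h1 : Integrable v (mu L) := (Lp.memLp v).integrable one_le_two
    exact IntegrableOn.locallyIntegrableOn h1
  have h0 := isOpen_Ioo.ae_eq_zero_of_integral_contDiff_smul_eq_zero hloc (by
    intro g hg hgc hgs
    have ht : IsTestFun L (fun x => (g x : ℂ)) :=
      ⟨Complex.ofRealCLM.contDiff.comp hg, hgc.comp_left Complex.ofReal_zero,
        (tsupport_comp_subset Complex.ofReal_zero g).trans hgs⟩
    have h1 := (Submodule.mem_orthogonal _ _).1 hv _ (h ⟨_, ht, ht.memLp.coeFn_toLp⟩)
    rw [L2.inner_def] at h1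
    rw [← setIntegral_eq_integral_of_forall_compl_eq_zero (s := Ioo 0 L), ← h1]
    · refine integral_congr_ae ?_
      filter_upwards [ht.memLp.coeFn_toLp] with x hx
      rw [hx, RCLike.inner_apply, Complex.conj_ofReal, Complex.real_smul, mul_comm]
    · intro x hx
      rw [image_eq_zero_of_notMem_tsupport fun h => hx (hgs h), zero_smul])
  apply Lp.ext
  have h1 : ∀ᵐ x ∂(mu L), v x = 0 := (ae_restrict_iff' measurableSet_Ioo).2 h0
  filter_upwards [h1, Lp.coeFn_zero ℂ 2 (mu L)] with x hx hx'
  rw [hx, hx']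
  rfl

end TestFunctions

/-! ### The hierarchy as vectors of the Hilbert space -/

section Operators

open Set Filter Topology
open scoped ContDiff

variable {p : Params}

theorem ae_mem_Ioo (L : ℝ) : ∀ᵐ x ∂(mu L), x ∈ Ioo 0 L := ae_restrict_mem measurableSet_Ioo

theorem Params.IsPhysical.mem_graph_opA (hp : p.IsPhysical) (m : ℕ) {G G' : ℝ → ℂ}
    {u v : Hilb p.L} (hG : ∀ x ∈ Ioo 0 p.L, HasDerivAt G (G' x) x)
    (hG' : ContinuousOn G' (Ioo 0 p.L)) (hu : u =ᵐ[mu p.L] G)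
    (hv : v =ᵐ[mu p.L] fun x => (p.hbar : ℂ) * G' x + (p.cotPotential (p.idx m) x : ℂ) * G x) :
    (u, v) ∈ (p.opA m).graph := by
  rw [PoschlTeller.mem_graph_opA]
  refine ⟨G, G', hasACDeriv_of_hasDerivAt hG hG', hu, ?_⟩
  filter_upwards [hv, ae_mem_Ioo p.L] with x h1 h2
  rw [h1, hp.superpot_eq m h2]

theorem Params.IsPhysical.isAdjointPair_opA (hp : p.IsPhysical) (m : ℕ) {G G' : ℝ → ℂ} {K : ℝ}
    {y z : Hilb p.L} (hG : ∀ x ∈ Ioo 0 p.L, HasDerivAt G (G' x) x)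
    (hG' : ContinuousOn G' (Ioo 0 p.L)) (hb : ∀ x ∈ Ioo 0 p.L, ‖G x‖ ≤ K * x)
    (hb' : ∀ x ∈ Ioo 0 p.L, ‖G x‖ ≤ K * (p.L - x)) (hy : y =ᵐ[mu p.L] G)
    (hz : z =ᵐ[mu p.L] fun x => -(p.hbar : ℂ) * G' x + (p.cotPotential (p.idx m) x : ℂ) * G x) :
    IsAdjointPair (p.opA m) y z := by
  intro u v huv
  rw [PoschlTeller.mem_graph_opA] at huv
  refine inner_eq_of_mem_graphA hp.L_pos hp.hbar_pos.ne' (fun x hx => ?_) hG hG' hb hb' huv hy ?_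
  · rw [hp.superpot_eq m hx, Complex.conj_ofReal]
  · filter_upwards [hz, ae_mem_Ioo p.L] with x h1 h2
    rw [h1, hp.superpot_eq m h2]

theorem Params.IsPhysical.contDiffOn_cotPotential (hp : p.IsPhysical) (s : ℝ) :
    ContDiffOn ℝ ∞ (fun x => (p.cotPotential s x : ℂ)) (Ioo 0 p.L) := by
  refine Complex.ofRealCLM.contDiff.comp_contDiffOn (contDiffOn_const.mul
    ((contDiffOn_const.mul ?_).sub contDiffOn_const))
  have ha : ContDiff ℝ ∞ fun x : ℝ => Real.pi * x / p.L := by fun_prop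
  have h : p.cot = fun x => Real.cos (Real.pi * x / p.L) / Real.sin (Real.pi * x / p.L) := by
    funext x
    exact Real.cot_eq_cos_div_sin _
  rw [h]
  exact (Real.contDiff_cos.comp ha).contDiffOn.div (Real.contDiff_sin.comp ha).contDiffOn
    fun x hx => (hp.sin_pos hx).ne'

theorem Params.IsPhysical.isTestFun_apply (hp : p.IsPhysical) (s : ℝ) (c : ℂ) {φ : ℝ → ℂ}
    (hφ : IsTestFun p.L φ) :
    IsTestFun p.L (fun x => c * deriv φ x + (p.cotPotential s x : ℂ) * φ x) :=
  (hφ.deriv.mul_left contDiffOn_const).add (hφ.mul_left (hp.contDiffOn_cotPotential s))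

theorem IsTestFun.hasDerivAt {L : ℝ} {φ : ℝ → ℂ} (hφ : IsTestFun L φ) (x : ℝ) :
    HasDerivAt φ (_root_.deriv φ x) x :=
  (hφ.contDiff.differentiable (by simp) x).hasDerivAt

theorem Params.IsPhysical.opA_testVectors (hp : p.IsPhysical) (m : ℕ) {u : Hilb p.L}
    (hu : u ∈ testVectors p.L) : ∃ v ∈ testVectors p.L, (u, v) ∈ (p.opA m).graph := by
  obtain ⟨φ, hφ, hu⟩ := hu
  have ht := hp.isTestFun_apply (p.idx m) p.hbar hφ
  exact ⟨ht.memLp.toLp _, ⟨_, ht, ht.memLp.coeFn_toLp⟩,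
    hp.mem_graph_opA m (fun x _ => hφ.hasDerivAt x) hφ.deriv.contDiff.continuous.continuousOn hu
      ht.memLp.coeFn_toLp⟩

theorem Params.IsPhysical.dense_opA (hp : p.IsPhysical) (m : ℕ) :
    Dense ((p.opA m).domain : Set (Hilb p.L)) :=
  dense_of_testVectors_subset fun _ hu =>
    let ⟨_, _, h⟩ := hp.opA_testVectors m hu
    LinearPMap.mem_domain_of_mem_graph h

theorem Params.IsPhysical.opA_adjoint_testVectors (hp : p.IsPhysical) (m : ℕ) {u : Hilb p.L}
    (hu : u ∈ testVectors p.L) : ∃ v ∈ testVectors p.L, (u, v) ∈ (p.opA m).adjoint.graph := by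
  obtain ⟨φ, hφ, hu⟩ := hu
  have ht := hp.isTestFun_apply (p.idx m) (-p.hbar) hφ
  obtain ⟨K, hK, hK'⟩ := hφ.exists_bound
  exact ⟨ht.memLp.toLp _, ⟨_, ht, ht.memLp.coeFn_toLp⟩, (mem_graph_adjoint (hp.dense_opA m)).2
    (hp.isAdjointPair_opA m (fun x _ => hφ.hasDerivAt x)
      hφ.deriv.contDiff.continuous.continuousOn hK hK' hu ht.memLp.coeFn_toLp)⟩

/-- Without density the adjoint of the product would not be described by its defining relation. Each
factor preserves the test vectors, so the natural domain contains them. -/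
theorem Params.IsPhysical.dense_opLambda (hp : p.IsPhysical) (m n : ℕ) :
    Dense ((p.opLambda m n).domain : Set (Hilb p.L)) := by
  refine dense_of_testVectors_subset (mem_domain_opProd _ fun S hS u hu => ?_)
  obtain ⟨k, -, rfl⟩ := List.mem_map.1 hS
  exact hp.opA_testVectors k hu

theorem Params.IsPhysical.dense_opTheta (hp : p.IsPhysical) (n m : ℕ) :
    Dense ((p.opTheta n m).domain : Set (Hilb p.L)) := by
  refine dense_of_testVectors_subset (mem_domain_opProd _ fun S hS u hu => ?_)
  obtain ⟨k, -, rfl⟩ := List.mem_map.1 hS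
  exact hp.opA_adjoint_testVectors k hu

/-- The function `A_{m-1} ⋯ A_0 φ_j / √((2M)^m ∏_{k < m} (E_j - E_k))`, which is `φ^{(m)}_{j-m}`
for `m ≤ j`. -/
noncomputable def Params.stage (p : Params) (m j : ℕ) (x : ℝ) : ℂ :=
  p.ladder m j x / (p.hierNorm m j : ℂ)

/-- The constant factor of `stage m j`. -/
noncomputable def Params.stageConst (p : Params) (m j : ℕ) : ℂ :=
  (p.normConst j * p.scale ^ m / p.hierNorm m j : ℝ)

theorem Params.IsPhysical.stage_eq (hp : p.IsPhysical) (m j : ℕ) {x : ℝ} (hx : x ∈ Ioo 0 p.L) :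
    p.stage m j x = p.stageConst m j * p.profile (p.idx j) (p.ladderPoly j m) x := by
  rw [Params.stage, hp.ladder_eq m j hx, Params.stageConst]
  push_cast
  ring

theorem Params.IsPhysical.stage_ae_eq (hp : p.IsPhysical) (m j : ℕ) :
    p.stage m j =ᵐ[mu p.L]
      fun x => p.stageConst m j * p.profile (p.idx j) (p.ladderPoly j m) x := by
  filter_upwards [ae_mem_Ioo p.L] with x hx using hp.stage_eq m j hx

theorem Params.IsPhysical.exists_norm_ladderPoly_le (hp : p.IsPhysical) (m j : ℕ) :
    ∃ K, 0 ≤ K ∧ ∀ x ∈ Ioo 0 p.L, ‖p.profile (p.idx j) (p.ladderPoly j m) x‖ ≤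
      K * Real.sin (Real.pi * x / p.L) := by
  rcases le_or_gt m j with h | h
  · exact hp.exists_norm_profile_le (hp.le_idx h) fun k hk => hp.coeff_ladderPoly j m k (by omega)
  · refine ⟨0, le_rfl, fun x _ => ?_⟩
    rw [hp.ladderPoly_eq_zero h, profile_zero, norm_zero, zero_mul]

theorem Params.IsPhysical.memLp_stage (hp : p.IsPhysical) (m j : ℕ) :
    MemLp (p.stage m j) 2 (mu p.L) := by
  obtain ⟨K, hK, hb⟩ := hp.exists_norm_ladderPoly_le m j
  have h : MemLp (p.profile (p.idx j) (p.ladderPoly j m)) 2 (mu p.L) :=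
    memLp_of_continuousOn_of_bound (hp.continuousOn_profile (hp.idx_pos j).ne' _) fun x hx =>
      (hb x hx).trans (mul_le_of_le_one_right hK (Real.sin_le_one _))
  exact (memLp_congr_ae (hp.stage_ae_eq m j)).2 (h.const_mul _)

/-- The class of `stage m j`. -/
noncomputable def Params.IsPhysical.vec (hp : p.IsPhysical) (m j : ℕ) : Hilb p.L :=
  (hp.memLp_stage m j).toLp (p.stage m j)

theorem Params.IsPhysical.vec_ae_eq (hp : p.IsPhysical) (m j : ℕ) :
    hp.vec m j =ᵐ[mu p.L]
      fun x => p.stageConst m j * p.profile (p.idx j) (p.ladderPoly j m) x :=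
  (hp.memLp_stage m j).coeFn_toLp.trans (hp.stage_ae_eq m j)

theorem Params.IsPhysical.step_mul_stageConst (hp : p.IsPhysical) {m j : ℕ} (h : m < j) :
    (p.step m j : ℂ) * p.stageConst (m + 1) j = p.stageConst m j * p.scale := by
  have h1 : p.hierNorm (m + 1) j = p.hierNorm m j * p.step m j := by
    rw [hp.hierNorm_eq h, hp.hierNorm_eq h.le, Finset.prod_range_succ]
  have h2 := (hp.step_pos h).ne'
  have h3 := (hp.hierNorm_pos h.le).ne'
  simp only [Params.stageConst]
  rw [← Complex.ofReal_mul, ← Complex.ofReal_mul, h1]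
  congr 1
  field_simp
  ring

theorem Params.IsPhysical.hasDerivAt_stage (hp : p.IsPhysical) (c : ℂ) (j : ℕ)
    (Q : Polynomial ℂ) {x : ℝ} (hx : x ∈ Ioo 0 p.L) :
    HasDerivAt (fun x => c * p.profile (p.idx j) Q x)
      (c * ((Real.pi / p.L : ℝ) * p.profile (p.idx j) (p.derivPoly (p.idx j) Q) x)) x :=
  (hp.hasDerivAt_profile (hp.idx_pos j).ne' Q hx).const_mul c

theorem Params.IsPhysical.continuousOn_deriv_stage (hp : p.IsPhysical) (c : ℂ) (j : ℕ)
    (Q : Polynomial ℂ) : ContinuousOn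
      (fun x => c * ((Real.pi / p.L : ℝ) * p.profile (p.idx j) (p.derivPoly (p.idx j) Q) x))
      (Ioo 0 p.L) :=
  continuousOn_const.mul (continuousOn_const.mul
    (hp.continuousOn_profile (hp.idx_pos j).ne' _))

/-- `A_m φ^{(m)}_{n+1} = √(2M (E_{n+m+1} - E_m)) φ^{(m+1)}_n`. -/
theorem Params.IsPhysical.opA_vec (hp : p.IsPhysical) (m j : ℕ) :
    (hp.vec m j, (p.step m j : ℂ) • hp.vec (m + 1) j) ∈ (p.opA m).graph := by
  refine hp.mem_graph_opA m (fun x hx => hp.hasDerivAt_stage _ j _ hx)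
    (hp.continuousOn_deriv_stage _ j _) (hp.vec_ae_eq m j) ?_
  filter_upwards [hp.vec_ae_eq (m + 1) j, Lp.coeFn_smul (p.step m j : ℂ) (hp.vec (m + 1) j)]
    with x h1 h2
  have h3 := profile_lowerPoly p (p.idx j) (p.idx m) x (p.ladderPoly j m)
  rw [h2, Pi.smul_apply, h1, smul_eq_mul]
  rcases lt_or_ge m j with h | h
  · have h4 := hp.step_mul_stageConst h
    rw [Params.ladderPoly]
    linear_combination p.profile (p.idx j) (lowerPoly p.beta (p.idx j) (p.idx m)
      (p.ladderPoly j m)) x * h4 - p.stageConst m j * h3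
  -- From m = j on, both sides vanish, so the relation needs no bound on m.
  · have h4 := hp.ladderPoly_eq_zero (Nat.lt_succ_of_le h)
    rw [h4, profile_zero]
    rw [Params.ladderPoly] at h4
    rw [h4, profile_zero] at h3
    linear_combination -p.stageConst m j * h3

theorem Params.IsPhysical.isAdjointPair_vec (hp : p.IsPhysical) (m j : ℕ) :
    IsAdjointPair (p.opA m) (hp.vec (m + 1) j) ((p.step m j : ℂ) • hp.vec m j) := by
  obtain ⟨K, hK0, hK⟩ := hp.exists_norm_ladderPoly_le (m + 1) j
  have hb : ∀ x ∈ Ioo 0 p.L,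
      ‖p.stageConst (m + 1) j * p.profile (p.idx j) (p.ladderPoly j (m + 1)) x‖ ≤
        ‖p.stageConst (m + 1) j‖ * K * Real.sin (Real.pi * x / p.L) := by
    intro x hx
    rw [norm_mul, mul_assoc]
    exact mul_le_mul_of_nonneg_left (hK x hx) (norm_nonneg _)
  have hc : 0 ≤ ‖p.stageConst (m + 1) j‖ * K := mul_nonneg (norm_nonneg _) hK0
  refine hp.isAdjointPair_opA m (K := ‖p.stageConst (m + 1) j‖ * K * (Real.pi / p.L))
    (fun x hx => hp.hasDerivAt_stage _ j _ hx)
    (hp.continuousOn_deriv_stage _ j _) (fun x hx => (hb x hx).trans ?_)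
    (fun x hx => (hb x hx).trans ?_) (hp.vec_ae_eq (m + 1) j) ?_
  · rw [mul_assoc _ (Real.pi / p.L)]
    exact mul_le_mul_of_nonneg_left (hp.sin_le hx).1 hc
  · rw [mul_assoc _ (Real.pi / p.L)]
    exact mul_le_mul_of_nonneg_left (hp.sin_le hx).2 hc
  filter_upwards [hp.vec_ae_eq m j, Lp.coeFn_smul (p.step m j : ℂ) (hp.vec m j)]
    with x h1 h2
  have h3 := profile_raisePoly p (p.idx j) (p.idx m) x (p.ladderPoly j (m + 1))
  rw [h2, Pi.smul_apply, h1, smul_eq_mul]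
  rcases lt_or_ge m j with h | h
  · have h4 := hp.step_mul_stageConst h
    have h5 : (p.step m j : ℂ) ^ 2 = (p.scale : ℂ) ^ 2 * p.gap m j := by
      exact_mod_cast hp.sq_step h.le
    have hs : (p.scale : ℂ) ≠ 0 := Complex.ofReal_ne_zero.2 hp.scale_pos.ne'
    rw [hp.raisePoly_lowerPoly, profile_C_mul, hp.energyGap_eq] at h3
    -- After multiplication by the scale, `step² = scale² · gap` and the recursion of the
    -- normalizations give the identity.
    refine mul_left_cancel₀ hs ?_
    linear_combination (-(p.step m j : ℂ) * p.profile (p.idx j) (p.ladderPoly j m) x) * h4 +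
      (p.stageConst (m + 1) j * p.profile (p.idx j) (p.ladderPoly j m) x) * h5 -
      p.scale * p.stageConst (m + 1) j * h3
  · have h4 := hp.ladderPoly_eq_zero (Nat.lt_succ_of_le h)
    rw [h4, raisePoly_zero, profile_zero] at h3
    -- At m = j the coefficient is zero; for m > j the function is.
    have h5 : (p.step m j : ℂ) * p.profile (p.idx j) (p.ladderPoly j m) x = 0 := by
      rcases h.eq_or_lt with rfl | h
      · rw [p.step_self, Complex.ofReal_zero, zero_mul]
      · rw [hp.ladderPoly_eq_zero h, profile_zero, mul_zero]
    rw [h4, profile_zero]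
    linear_combination p.stageConst m j * h5 - p.stageConst (m + 1) j * h3

theorem Params.IsPhysical.opA_adjoint_vec (hp : p.IsPhysical) (m j : ℕ) :
    (hp.vec (m + 1) j, (p.step m j : ℂ) • hp.vec m j) ∈ (p.opA m).adjoint.graph :=
  (mem_graph_adjoint (hp.dense_opA m)).2 (hp.isAdjointPair_vec m j)

theorem Params.IsPhysical.inner_vec_zero (hp : p.IsPhysical) (j : ℕ) :
    ⟪hp.vec 0 j, hp.vec 0 j⟫_ℂ = 1 := by
  set N := ∫ x in (0 : ℝ)..p.L, ‖p.rawEigenfun j x‖ ^ 2 with hN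
  have hN0 : 0 < N := hp.integral_pos j
  have hc : p.stageConst 0 j = ((Real.sqrt N)⁻¹ : ℝ) := by
    simp [Params.stageConst, Params.hierNorm, Params.normConst, hN]
  have h1 : ∀ᵐ x ∂(mu p.L), ⟪hp.vec 0 j x, hp.vec 0 j x⟫_ℂ =
      ((N⁻¹ * ‖p.profile (p.idx j) (p.ladderPoly j 0) x‖ ^ 2 : ℝ) : ℂ) := by
    filter_upwards [hp.vec_ae_eq 0 j] with x hx
    rw [hx, inner_self_eq_norm_sq_to_K, norm_mul, hc, Complex.norm_real,
      Real.norm_of_nonneg (by positivity)]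
    change (((Real.sqrt N)⁻¹ * ‖p.profile (p.idx j) (p.ladderPoly j 0) x‖ : ℝ) : ℂ) ^ 2 = _
    rw [← Complex.ofReal_pow, mul_pow, inv_pow, Real.sq_sqrt hN0.le]
  rw [L2.inner_def, integral_congr_ae h1, integral_complex_ofReal, integral_const_mul,
    ← integral_norm_rawEigenfun hp, ← hN, inv_mul_cancel₀ hN0.ne', Complex.ofReal_one]

/-- Pairing A_m e_m = r e_{m+1} with A_m† e_{m+1} = r e_m gives r‖e_{m+1}‖² = r‖e_m‖², and r > 0 for
m < j. -/
theorem Params.IsPhysical.inner_vec (hp : p.IsPhysical) {m j : ℕ} (h : m ≤ j) :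
    ⟪hp.vec m j, hp.vec m j⟫_ℂ = 1 := by
  induction m with
  | zero => exact hp.inner_vec_zero j
  | succ m ih =>
    have h1 := hp.isAdjointPair_vec m j _ _ (hp.opA_vec m j)
    rw [inner_smul_left, inner_smul_right, Complex.conj_ofReal, ih (by omega)] at h1
    exact mul_left_cancel₀ (Complex.ofReal_ne_zero.2 (hp.step_pos h).ne') h1

/-! ### Mean values -/

theorem inner_smul_smul_self {L : ℝ} {u : Hilb L} (hu : ⟪u, u⟫_ℂ = 1) (c : ℝ) {w : Hilb L}
    (hw : w = (c : ℂ) • (c : ℂ) • u) : ⟪u, w⟫_ℂ = ((c ^ 2 : ℝ) : ℂ) := by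
  rw [hw, inner_smul_right, inner_smul_right, hu]
  push_cast
  ring

/-- Only the initial state must be normalized; the intermediate vector may be zero, when the chain
runs past its top level. -/
theorem Params.IsPhysical.hasMean_of_graph (hp : p.IsPhysical) {X Y : Hilb p.L →ₗ.[ℂ] Hilb p.L}
    {m n k : ℕ} {c : ℝ} (hX : (hp.vec m (n + m), (c : ℂ) • hp.vec k (n + m)) ∈ X.graph)
    (hY : (hp.vec k (n + m), (c : ℂ) • hp.vec m (n + m)) ∈ Y.graph) :
    HasMean (opMul Y X) (p.hierEigenfun m n) ((c ^ 2 : ℝ) : ℂ) :=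
  hasMean_of_mem_graph (hp.memLp_stage m (n + m))
    (mem_graph_opMul.2 ⟨_, hX, smul_mem_graph hY c⟩)
    (inner_smul_smul_self (hp.inner_vec (Nat.le_add_left m n)) c rfl)

theorem Params.IsPhysical.opLambda_vec (hp : p.IsPhysical) {m n : ℕ} (h : m < n) (j : ℕ) :
    (hp.vec (m + 1) j, ((∏ k ∈ Finset.Ico (m + 1) (n + 1), p.step k j : ℝ) : ℂ) •
    hp.vec (n + 1) j) ∈ (p.opLambda m n).graph := by
  rw [Complex.ofReal_prod]
  exact mem_graph_opProd_reverse p.opA (fun k => hp.vec k j) (fun k => (p.step k j : ℂ))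
    (fun k => hp.opA_vec k j) (by omega)

theorem Params.IsPhysical.opLambda_adjoint_vec (hp : p.IsPhysical) {m n : ℕ} (h : m < n) (j : ℕ) :

    (hp.vec (n + 1) j, ((∏ k ∈ Finset.Ico (m + 1) (n + 1), p.step k j : ℝ) : ℂ) •
      hp.vec (m + 1) j) ∈ (p.opLambda m n).adjoint.graph := by
  rw [Complex.ofReal_prod, mem_graph_adjoint (hp.dense_opLambda m n)]
  exact isAdjointPair_opProd_reverse p.opA (fun k => hp.vec k j) (fun k => (p.step k j : ℂ))
    (fun k => hp.isAdjointPair_vec k j) (by omega)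

theorem Params.IsPhysical.opTheta_vec (hp : p.IsPhysical) {m n : ℕ} (h : m < n) (j : ℕ) :
    (hp.vec (n + 1) j, ((∏ k ∈ Finset.Ico (m + 1) (n + 1), p.step k j : ℝ) : ℂ) •
    hp.vec (m + 1) j) ∈ (p.opTheta m n).graph := by
  rw [Complex.ofReal_prod]
  exact mem_graph_opProd (fun k => (p.opA k).adjoint) (fun k => hp.vec k j)
    (fun k => (p.step k j : ℂ)) (fun k => hp.opA_adjoint_vec k j) (by omega)

theorem Params.IsPhysical.opTheta_adjoint_vec (hp : p.IsPhysical) {m n : ℕ} (h : m < n) (j : ℕ) :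

    (hp.vec (m + 1) j, ((∏ k ∈ Finset.Ico (m + 1) (n + 1), p.step k j : ℝ) : ℂ) •
      hp.vec (n + 1) j) ∈ (p.opTheta m n).adjoint.graph := by
  rw [Complex.ofReal_prod, mem_graph_adjoint (hp.dense_opTheta m n)]
  exact isAdjointPair_opProd (fun k => (p.opA k).adjoint) (fun k => hp.vec k j)
    (fun k => (p.step k j : ℂ))
    (fun k => isAdjointPair_adjoint (hp.dense_opA k) (hp.opA_vec k j)) (by omega)

end Operators

/-! ### The constants 𝓜 and 𝓝 as products of energy gaps. -/

section Constants

variable {p : Params}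

/-- The product of the dimensionless energy differences over the first `a` levels. -/
noncomputable def Params.gapProd (p : Params) (a j : ℕ) : ℝ :=
  ∏ k ∈ Finset.range a, p.gap k j

theorem Params.IsPhysical.gapProd_pos (hp : p.IsPhysical) {a j : ℕ} (h : a ≤ j) :
    0 < p.gapProd a j :=
  Finset.prod_pos fun _ hk => hp.gap_pos ((Finset.mem_range.1 hk).trans_le h)

theorem Params.gapProd_eq_zero (p : Params) {a j : ℕ} (h : j < a) : p.gapProd a j = 0 :=
  Finset.prod_eq_zero (Finset.mem_range.2 h) (p.gap_self j)

/-- On the level j = n+m+1 the difference and the sum of the shifted quantum numbers of j and k are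
n+m-k+1 and n+m+2ν+k+3. -/
theorem constM_eq (p : Params) (n m : ℕ) :
    p.constM n m = Real.sqrt (p.gapProd (m + 1) (n + (m + 1))) := by
  rw [Params.constM, Params.gapProd]
  congr 1
  refine Finset.prod_congr rfl fun k _ => ?_
  unfold Params.gap Params.idx
  push_cast
  congr 2
  · ring
  · ring
  · rw [show (n : ℝ) + (m + 1) + p.nu + 1 = n + m + p.nu + 2 by ring]

theorem constN_eq (p : Params) (n m : ℕ) : p.constN n m = p.gapProd (m + 1) (n + (n + 1)) := by
  rw [Params.constN, Params.gapProd]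
  refine Finset.prod_congr rfl fun k _ => ?_
  unfold Params.gap Params.idx
  push_cast
  congr 2
  · ring
  · ring
  · rw [show (n : ℝ) + (n + 1) + p.nu + 1 = 2 * n + p.nu + 2 by ring]

/-- The squares of the coefficients of the chains of ladder operators. -/
theorem Params.IsPhysical.sq_prod_step (hp : p.IsPhysical) {m n j : ℕ} (h : m < n) (hm : m < j) :
    (∏ k ∈ Finset.Ico (m + 1) (n + 1), p.step k j) ^ 2 =
      (p.scale ^ (n - m)) ^ 2 * (p.gapProd (n + 1) j * (p.gapProd (m + 1) j)⁻¹) := by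
  rcases le_or_gt j n with hj | hj
  -- The chain crosses its top level k = j, where both the coefficient and the gap vanish.
  · have h0 : ∏ k ∈ Finset.Ico (m + 1) (n + 1), p.step k j = 0 :=
      Finset.prod_eq_zero (Finset.mem_Ico.2 ⟨hm, Nat.lt_succ_of_le hj⟩) (p.step_self j)
    rw [h0, p.gapProd_eq_zero (Nat.lt_succ_of_le hj)]
    ring
  · have h1 : p.gapProd (n + 1) j =
        p.gapProd (m + 1) j * ∏ k ∈ Finset.Ico (m + 1) (n + 1), p.gap k j :=
      (Finset.prod_range_mul_prod_Ico _ (by omega)).symm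
    have h2 := (hp.gapProd_pos (a := m + 1) (j := j) hm).ne'
    rw [h1, mul_comm (p.gapProd (m + 1) j), mul_inv_cancel_right₀ h2, ← Finset.prod_pow,
      Finset.prod_congr rfl fun k hk =>
        hp.sq_step ((Nat.lt_succ_iff.1 (Finset.mem_Ico.1 hk).2).trans hj.le),
      Finset.prod_mul_distrib, Finset.prod_const, Nat.card_Ico, ← pow_mul, ← pow_mul]
    congr 2
    omega

/-- The quotient of the constants `𝓜`. -/
theorem Params.IsPhysical.sq_constM_div (hp : p.IsPhysical) (n m : ℕ) :
    (p.constM m n * (p.constM n m)⁻¹) ^ 2 =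
      p.gapProd (n + 1) (n + (m + 1)) * (p.gapProd (m + 1) (n + (m + 1)))⁻¹ := by
  rw [constM_eq, constM_eq, mul_pow, inv_pow, show m + (n + 1) = n + (m + 1) by omega,
    Real.sq_sqrt (hp.gapProd_pos (by omega)).le, Real.sq_sqrt (hp.gapProd_pos (by omega)).le]

end Constants

end PoschlTeller

theorem corollary2 (p : PoschlTeller.Params)
    (hhbar : 0 < p.hbar) (hmass : 0 < p.mass) (hL : 0 < p.L)
    (hnu : 0 ≤ p.nu) (hbeta : 0 ≤ p.beta) :
    (∀ n m : ℕ, m < n →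
      PoschlTeller.HasMean
          (PoschlTeller.opMul (p.opLambda m n) (p.opLambda m n).adjoint)
          (p.hierEigenfun (n + 1) n)
          ((((p.hbar * Real.pi / p.L) ^ (n - m)) ^ 2 *
            (p.constN n n * (p.constN n m)⁻¹) : ℝ) : ℂ) ∧
      PoschlTeller.HasMean
          (PoschlTeller.opMul (p.opLambda m n).adjoint (p.opLambda m n))
          (p.hierEigenfun (m + 1) n)
          ((((p.hbar * Real.pi / p.L) ^ (n - m) *
            (p.constM m n * (p.constM n m)⁻¹)) ^ 2 : ℝ) : ℂ)) ∧
    (∀ n m : ℕ, n < m →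
      PoschlTeller.HasMean
          (PoschlTeller.opMul (p.opTheta n m) (p.opTheta n m).adjoint)
          (p.hierEigenfun (n + 1) n)
          ((((p.hbar * Real.pi / p.L) ^ (m - n)) ^ 2 *
            ((p.constN n n)⁻¹ * p.constN n m) : ℝ) : ℂ) ∧
      PoschlTeller.HasMean
          (PoschlTeller.opMul (p.opTheta n m).adjoint (p.opTheta n m))
          (p.hierEigenfun (m + 1) n)
          ((((p.hbar * Real.pi / p.L) ^ (m - n) *
            (p.constM n m * (p.constM m n)⁻¹)) ^ 2 : ℝ) : ℂ)) ∧
    (∀ n : ℕ, p.constN n n = p.constM n n ^ 2) := by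
  have hp : p.IsPhysical := ⟨hhbar, hmass, hL, hnu, hbeta⟩
  refine ⟨fun n m h => ⟨?_, ?_⟩, fun n m h => ⟨?_, ?_⟩, fun n => ?_⟩
  · rw [PoschlTeller.constN_eq, PoschlTeller.constN_eq]
    -- The state φ_n^{(n+1)} lies on the level j = 2n + 1.
    have := hp.hasMean_of_graph (hp.opLambda_adjoint_vec h (n + (n + 1)))
      (hp.opLambda_vec h (n + (n + 1)))
    rwa [hp.sq_prod_step h (by omega)] at this
  · rw [mul_pow, hp.sq_constM_div]
    have := hp.hasMean_of_graph (hp.opLambda_vec h (n + (m + 1)))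
      (hp.opLambda_adjoint_vec h (n + (m + 1)))
    rwa [hp.sq_prod_step h (by omega)] at this
  · rw [PoschlTeller.constN_eq, PoschlTeller.constN_eq, mul_comm (p.gapProd _ _)⁻¹]
    -- For m > 2n the chain passes the top level 2n + 1 and both sides are zero, a case that
    -- `sq_prod_step` includes.
    have := hp.hasMean_of_graph (hp.opTheta_adjoint_vec h (n + (n + 1)))
      (hp.opTheta_vec h (n + (n + 1)))
    rwa [hp.sq_prod_step h (by omega)] at this
  · rw [mul_pow, hp.sq_constM_div, show m + (n + 1) = n + (m + 1) by omega]
    have := hp.hasMean_of_graph (hp.opTheta_vec h (n + (m + 1)))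
      (hp.opTheta_adjoint_vec h (n + (m + 1)))
    rwa [hp.sq_prod_step h (by omega)] at this
  · rw [PoschlTeller.constN_eq, PoschlTeller.constM_eq, Real.sq_sqrt (hp.gapProd_pos (by omega)).le]
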